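/- **Koch type sets.** Let $A_{0,1}\subset\mathbb R^2$ be a non-degenerate closed segment (the base) and let $T_{0,1}$ be the closed isosceles triangle (cap) on the base $A_{0,1}$ with height $\varepsilon\,\mathcal H^1(A_{0,1})$, where $0<\varepsilon<1/100$; let $\theta_{0,1}=\arctan(2\varepsilon)$ be its base angle. Given the $2^n$ caps $T_{n,1},\dots,T_{n,2^n}$, let $A_{n+1,2i-1},A_{n+1,2i}$ be the two shorter sides of $T_{n,i}$ (numbered consecutively from one end point of the base to the other), and let $T_{n+1,2i-1},T_{n+1,2i}\subset T_{n,i}$ be isosceles triangles with bases $A_{n+1,2i-1},A_{n+1,2i}$ and base angles $0<\theta_{n+1,2i-1},\theta_{n+1,2i}\le\theta_{n,i}$, otherwise arbitrary. Put $A^*=\bigcap_{n\ge 0}\bigcup_{i=1}^{2^n}T_{n,i}$ and let $E$ be the set of all vertices of the caps $T_{n,i}$ ($n\ge1$). A Koch type set is a set $A\in\{A^*,\,A^*\setminus E\}$ arising in this way. **The map $\mathcal F$.** Let $\tilde A_n=\bigcup_{i=1}^{2^n}A_{n,i}$, and let $f_n:\tilde A_n\to\tilde A_{n+1}$ be the map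 that moves each $y\in A_{n,i}$ orthogonally to $A_{n,i}$ onto the union $A_{n+1,2i-1}\cup A_{n+1,2i}$ of the two shorter sides of $T_{n,i}$. For $x\in A_{0,1}$ let $\mathcal F(x)=\lim_{n\to\infty}(f_n\circ\cdots\circ f_0)(x)$. **The product $\tilde\Pi$.** For $p\in A^*$ let $i(n,p)$ be an index $i$ with $p\in T_{n,i}$ (the greatest one if there are two), and let $$\tilde\Pi(p)=\prod_{n=0}^\infty\frac1{\cos\theta_{n,i(n,p)}}\in[1,\infty];$$ for $x$ in the base write $\tilde\Pi(x)=\tilde\Pi(\mathcal F(x))$. Let $\Lambda_\infty=\{p\in A:\tilde\Pi(p)=\infty\}$ and $\Lambda_\infty^{-1}=\mathcal F^{-1}(\Lambda_\infty)\subset A_{0,1}$. **Theorem.** For every Koch type set $A$ and every $\mathcal H^1$-measurable subset $B$ of its base segment, $$\mathcal H^1(\mathcal F(B))=\int_{B\setminus\Lambda_\infty^{-1}}\tilde\Pi\,d\mathcal H^1+\mathcal H^1\big(\mathcal F(B)\cap\Lambda_\infty\big),$$ as an identity in $[0,\infty]$. -/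

import Mathlib

open MeasureTheory Filter Topology
open scoped ENNReal

noncomputable section

namespace Koch

/-- The Euclidean plane. -/
abbrev Plane : Type := EuclideanSpace ℝ (Fin 2)

/-- Counterclockwise rotation by a right angle. -/
def rot (v : Plane) : Plane := !₂[-(v 1), v 0]

/-- The parameters of a construction: the end points `a ≠ b` of the base segment, the relative
height `ε < 1/100` of the first cap, and the base angles `θ n i` (`i < 2 ^ n`) of the triangular
caps `T_{n,i}`.  The caps of each stage are numbered from `0`, so that the two caps built inside
the cap number `i` of stage `n` have the numbers `2 * i` and `2 * i + 1`.
The first cap has height `ε * |b - a|` over its base, i.e. `tan (θ 0 0) = 2 * ε`. -/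
structure Construction where
  a : Plane
  b : Plane
  a_ne_b : a ≠ b
  ε : ℝ
  ε_pos : 0 < ε
  ε_lt : ε < 1 / 100
  θ : ℕ → ℕ → ℝ
  θ_zero : θ 0 0 = Real.arctan (2 * ε)
  θ_pos : ∀ n i, i < 2 ^ n → 0 < θ n i
  θ_le : ∀ n i, i < 2 ^ (n + 1) → θ (n + 1) i ≤ θ n (i / 2)

namespace Construction

/-- The vertex `c` of the isosceles triangle with base from `l` to `r` and base angle `t`, on the
left of the vector `r - l` if `n` is even and on the right if `n` is odd.  When the base is one of
the two shorter sides of a cap of the previous stage (run through in the order of the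
construction), this is the side on which that cap lies, for `n ≥ 1`. -/
def apexOver (n : ℕ) (t : ℝ) (l r : Plane) : Plane :=
  midpoint ℝ l r + ((-1) ^ n * (Real.tan t / 2)) • rot (r - l)

variable (K : Construction)

/-- `K.vertex n k`, `k = 0, …, 2 ^ n`, are the consecutive vertices of the polygonal line `Ã_n`
from `a` to `b`: those of `Ã_{n+1}` are the ones of `Ã_n` with the apexes of the caps of stage `n`
inserted between them. -/
def vertex : ℕ → ℕ → Plane
  | 0, k => if k = 0 then K.a else K.b
  | n + 1, k =>
      if k % 2 = 0 then vertex n (k / 2)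
      else apexOver n (K.θ n (k / 2)) (vertex n (k / 2)) (vertex n (k / 2 + 1))

/-- The apex `a_{n,i}` of the cap `T_{n,i}`. -/
def apex (n i : ℕ) : Plane :=
  apexOver n (K.θ n i) (K.vertex n i) (K.vertex n (i + 1))

/-- The segment `A_{n,i}`. -/
def side (n i : ℕ) : Set Plane := segment ℝ (K.vertex n i) (K.vertex n (i + 1))

/-- The base segment. -/
def base : Set Plane := segment ℝ K.a K.b

/-- The triangular cap `T_{n,i}` on `A_{n,i}`. -/
def cap (n i : ℕ) : Set Plane :=
  convexHull ℝ {K.vertex n i, K.vertex n (i + 1), K.apex n i}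

/-- The stage `A_n`, the union of the `2 ^ n` caps of order `n`. -/
def stage (n : ℕ) : Set Plane := ⋃ i ∈ Finset.range (2 ^ n), K.cap n i

/-- The intersection of all stages. -/
def limitSet : Set Plane := ⋂ n, K.stage n

/-- The edge points: all vertices of caps. -/
def edgePoints : Set Plane :=
  ⋃ n ∈ Set.Ici 1, ⋃ i ∈ Finset.range (2 ^ n),
    {K.vertex n i, K.vertex n (i + 1), K.apex n i}

/-- `A` is a Koch type set obtained from the construction `K`: the intersection of all stages,
with or without its edge points. -/
def IsKochType (A : Set Plane) : Prop :=
  A = K.limitSet ∨ A = K.limitSet \ K.edgePoints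

/-- The map `f_{n,i}`, which lifts a point `y` of `A_{n,i}`, orthogonally to `A_{n,i}`, to the
union of the two shorter sides of the cap `T_{n,i}`; the height of the lift at `y` is `tan θ_{n,i}`
times the distance from `y` to the nearer end point of `A_{n,i}`. -/
def lift (n i : ℕ) (y : Plane) : Plane :=
  y + ((-1) ^ n * (Real.tan (K.θ n i) *
      min (dist y (K.vertex n i)) (dist y (K.vertex n (i + 1))) /
        dist (K.vertex n i) (K.vertex n (i + 1)))) •
    rot (K.vertex n (i + 1) - K.vertex n i)

/-- The number of a segment `A_{n,i}` containing `y` (the greatest one, if `y` is a common end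
point of two of them). -/
def sideIndex (n : ℕ) (y : Plane) : ℕ := sSup {i | i < 2 ^ n ∧ y ∈ K.side n i}

/-- The map `f_n` from `Ã_n` to `Ã_{n+1}`, equal to `f_{n,i}` on `A_{n,i}`. -/
def step (n : ℕ) (y : Plane) : Plane := K.lift n (K.sideIndex n y) y

/-- The composition `f_{n-1} ∘ ⋯ ∘ f_0`, from the base to `Ã_n`. -/
def approx : ℕ → Plane → Plane
  | 0, x => x
  | n + 1, x => K.step n (approx n x)

/-- The map `𝓕`, the pointwise limit on the base of the maps `f_n ∘ ⋯ ∘ f_0`. -/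
def F (x : Plane) : Plane := limUnder atTop (fun n => K.approx n x)

/-- `i(n,p)`: the number of a cap `T_{n,i}` containing `p` (the greatest one, if `p` is a common
vertex of two of them, so that `p` is then the first end point of `A_{n,i}`). -/
def capIndex (n : ℕ) (p : Plane) : ℕ := sSup {i | i < 2 ^ n ∧ p ∈ K.cap n i}

/-- The partial product `∏_{j ≤ n} (cos θ_{j,i(j,p)})⁻¹`. -/
def partialStretch (n : ℕ) (p : Plane) : ℝ≥0∞ :=
  ∏ j ∈ Finset.range (n + 1), ENNReal.ofReal (Real.cos (K.θ j (K.capIndex j p)))⁻¹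

/-- The infinite product `∏_j (cos θ_{j,i(j,p)})⁻¹ ∈ [1, ∞]` at a point `p` of a Koch type set.
All factors are at least `1` there, so it is the supremum of the partial products. -/
def stretch (p : Plane) : ℝ≥0∞ := ⨆ n, K.partialStretch n p

/-- The infinite product at a point `x` of the base, taken along the caps that contain the point
`𝓕 x` corresponding to `x`. -/
def baseStretch (x : Plane) : ℝ≥0∞ := K.stretch (K.F x)

/-- `Λ_∞`, the points of `A` at which the infinite product is infinite. -/
def lambdaInf (A : Set Plane) : Set Plane := {p | p ∈ A ∧ K.stretch p = ∞}

/-- `Λ_∞^{-1}`, the preimage of `Λ_∞` in the base under `𝓕`. -/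
def lambdaInfPreimage (A : Set Plane) : Set Plane := {x | x ∈ K.base ∧ K.F x ∈ K.lambdaInf A}

end Construction

end Koch

end

/-!
The theorem is an area formula for the limit curve of the polygonal lines `Ã_n`. Parametrize these
lines over `[0, 1]` so that the `2 ^ n` segments of stage `n` take the same time. The map `𝓕` is
then `t ↦ S.curve t`, except at the countably many dyadic times, which do not matter for `ℋ¹`. At
stage `n` the speed at the time `t` is the length of the base times the `n`-th partial product
`S.weight` (`SlopeTree.len_eq`); these speeds increase to the length of the base times the infinite
product `S.density`. As different caps of the same stage meet at most in a vertex
(`SlopeTree.eq_of_mem_cap_of_lt`), the curve is injective on `[0, 1)`, and `ℋ¹` on the curve can be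
regarded as a measure `S.curveMeasure` on the times. It is to be compared with the measure
`S.stretchMeasure` whose density is the limit of the speeds.

For every dyadic interval the curve measure is at least the stretch measure, because each of the
sub-arcs of a finer stage is at least as long as its chord
(`SlopeTree.stretchMeasure_le_curveMeasure`). For the whole curve it is at most the stretch measure,
because the caps of stage `n` cover the curve and have the lengths of their bases as diameters
(`SlopeTree.curveMeasure_univ_le`). If the stretch measure is finite, the two are therefore equal
(`SlopeTree.curveMeasure_eq`).

The stretch measure can be infinite, and then the first inequality says nothing about the part of
an arc on which the product is finite. This is overcome by stopping the construction, that is, by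
making the caps flat as soon as the product would exceed a bound `M` (`SlopeTree.truncate`). The
stopped curve has bounded speed, and at the times at which the product is at most `M` it passes
through the same points with the same product. So the area formula holds on every null measurable
set of times at which the product is finite (`SlopeTree.hausdorffMeasure_curve_image`). The times at
which it is infinite are mapped, up to countable sets, onto the part of `Λ_∞` on the curve, which is
measurably separated from the rest of the curve (`SlopeTree.hausdorffMeasure_curve_split`).
-/

noncomputable section

namespace Koch

/-! ### Frames, slope trees and their caps -/

/-- A tree of slopes over a segment: the data of a Koch type construction, recorded through the
tangents of the base angles.  In contrast to `Construction`, flat caps (slope `0`) are allowed, so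
that a construction can be stopped, and the slopes are indexed by all natural numbers, the
segments of stage `n` with number at least `2 ^ n` being degenerate. -/
structure SlopeTree where
  a : Plane
  b : Plane
  a_ne_b : a ≠ b
  slope : ℕ → ℕ → ℝ
  slope_nonneg : ∀ n i, 0 ≤ slope n i
  slope_zero_le : ∀ i, slope 0 i ≤ 1 / 2
  slope_succ_le : ∀ n i, slope (n + 1) i ≤ slope n (i / 2)

/-- The point with coordinates `(x, y)` in the frame in which `l` is the origin, `r` is `(1, 0)`
and the second axis points to the left of `r - l` if `s = 1` and to the right if `s = -1`. -/
def frame (s : ℝ) (l r : Plane) (x y : ℝ) : Plane := l + x • (r - l) + (s * y) • rot (r - l)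

theorem frame_apply_zero (s : ℝ) (l r : Plane) (x y : ℝ) :
    frame s l r x y 0 = l 0 + x * (r 0 - l 0) - s * y * (r 1 - l 1) := by
  simp [frame, rot]; ring

theorem frame_apply_one (s : ℝ) (l r : Plane) (x y : ℝ) :
    frame s l r x y 1 = l 1 + x * (r 1 - l 1) + s * y * (r 0 - l 0) := by
  simp [frame, rot]

theorem plane_ext {p q : Plane} (h0 : p 0 = q 0) (h1 : p 1 = q 1) : p = q := by
  ext k; fin_cases k <;> assumption

theorem dist_sq (p q : Plane) : dist p q ^ 2 = (p 0 - q 0) ^ 2 + (p 1 - q 1) ^ 2 := by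
  rw [EuclideanSpace.dist_eq, Real.sq_sqrt (by positivity)]
  simp [Fin.sum_univ_two, Real.dist_eq, sq_abs]

/-- A frame is a similarity whose ratio is the distance of its two base points. -/
theorem dist_frame {s : ℝ} (hs : s * s = 1) (l r : Plane) (x y x' y' : ℝ) :
    dist (frame s l r x y) (frame s l r x' y') =
      dist l r * √((x - x') ^ 2 + (y - y') ^ 2) := by
  rw [← sq_eq_sq₀ dist_nonneg (by positivity), mul_pow, Real.sq_sqrt (by positivity), dist_sq,
    dist_sq, frame_apply_zero, frame_apply_zero, frame_apply_one, frame_apply_one]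
  linear_combination (y - y') ^ 2 * ((l 0 - r 0) ^ 2 + (l 1 - r 1) ^ 2) * hs

theorem frame_zero (s : ℝ) (l r : Plane) : frame s l r 0 0 = l := by simp [frame]

theorem frame_one (s : ℝ) (l r : Plane) : frame s l r 1 0 = r := by simp [frame]

theorem neg_one_pow_mul_self (n : ℕ) : ((-1 : ℝ) ^ n) * (-1) ^ n = 1 := by
  rw [← mul_pow]; simp

/-- The isosceles triangle of slope `t` on the unit segment of the first axis. -/
def triangle (t : ℝ) : Set (ℝ × ℝ) :=
  {p | 0 ≤ p.1 ∧ p.1 ≤ 1 ∧ 0 ≤ p.2 ∧ p.2 ≤ t * p.1 ∧ p.2 ≤ t * (1 - p.1)}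

theorem isCompact_triangle {t : ℝ} (ht : 0 ≤ t) : IsCompact (triangle t) := by
  refine ((isCompact_Icc (a := (0 : ℝ)) (b := 1)).prod
    (isCompact_Icc (a := (0 : ℝ)) (b := t))).of_isClosed_subset ?_ ?_
  · have h1 : IsClosed {p : ℝ × ℝ | 0 ≤ p.1} := isClosed_le (by fun_prop) (by fun_prop)
    have h2 : IsClosed {p : ℝ × ℝ | p.1 ≤ 1} := isClosed_le (by fun_prop) (by fun_prop)
    have h3 : IsClosed {p : ℝ × ℝ | 0 ≤ p.2} := isClosed_le (by fun_prop) (by fun_prop)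
    have h4 : IsClosed {p : ℝ × ℝ | p.2 ≤ t * p.1} := isClosed_le (by fun_prop) (by fun_prop)
    have h5 : IsClosed {p : ℝ × ℝ | p.2 ≤ t * (1 - p.1)} := isClosed_le (by fun_prop) (by fun_prop)
    exact h1.inter (h2.inter (h3.inter (h4.inter h5)))
  · rintro ⟨x, y⟩ ⟨h1, h2, h3, h4, -⟩
    exact ⟨⟨h1, h2⟩, h3, h4.trans (mul_le_of_le_one_right ht h2)⟩

/-- The diameter of a flat isosceles triangle is the length of its base: the height over a point of
the base is at most the distance of that point to either end of the base, so that a vertical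
difference can be laid off on the part of the base that a horizontal one does not use. -/
theorem triangle_diam {t : ℝ} (h1 : t ≤ 1) {x y x' y' : ℝ}
    (h : (x, y) ∈ triangle t) (h' : (x', y') ∈ triangle t) : (x - x') ^ 2 + (y - y') ^ 2 ≤ 1 := by
  wlog hx : x ≤ x' generalizing x y x' y'
  · have := this h' h (not_le.1 hx).le
    linarith [sq_abs (x - x'), sub_sq_comm x x', sub_sq_comm y y']
  obtain ⟨hx0, hx1, hy0, hy1, hy2⟩ := h
  obtain ⟨hx0', hx1', hy0', hy1', hy2'⟩ := h'
  simp only at hx0 hx1 hy0 hy1 hy2 hx0' hx1' hy0' hy1' hy2'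
  rcases le_total y y' with hy | hy
  · have h2 : (x - x') ^ 2 ≤ x' ^ 2 := by nlinarith
    have h3 : (y - y') ^ 2 ≤ (1 - x') ^ 2 := by
      have : y' ≤ 1 - x' := hy2'.trans (mul_le_of_le_one_left (by linarith) h1)
      nlinarith
    nlinarith
  · have h2 : (x - x') ^ 2 ≤ (1 - x) ^ 2 := by nlinarith
    have h3 : (y - y') ^ 2 ≤ x ^ 2 := by
      have : y ≤ x := hy1.trans (mul_le_of_le_one_left hx0 h1)
      nlinarith
    nlinarith

namespace SlopeTree

variable (S : SlopeTree)

/-- `S.node n k` are the consecutive vertices of the polygonal line of stage `n`; all those with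
`k ≥ 2 ^ n` are equal to `S.b`. -/
def node : ℕ → ℕ → Plane
  | 0, k => if k = 0 then S.a else S.b
  | n + 1, k =>
      if k % 2 = 0 then node n (k / 2)
      else frame ((-1) ^ n) (node n (k / 2)) (node n (k / 2 + 1)) (1 / 2) (S.slope n (k / 2) / 2)

/-- The point with coordinates `(x, y)` in the frame of the segment number `i` of stage `n`, the
second axis pointing to the side of its cap. -/
def pt (n i : ℕ) (x y : ℝ) : Plane := frame ((-1) ^ n) (S.node n i) (S.node n (i + 1)) x y

/-- The length of the segment number `i` of stage `n`. -/
def len (n i : ℕ) : ℝ := dist (S.node n i) (S.node n (i + 1))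

theorem slope_le (n i : ℕ) : S.slope n i ≤ 1 / 2 := by
  induction n generalizing i with
  | zero => exact S.slope_zero_le i
  | succ n ih => exact (S.slope_succ_le n i).trans (ih _)

theorem node_succ_even (n i : ℕ) : S.node (n + 1) (2 * i) = S.node n i := by
  simp [node]

theorem node_succ_odd (n i : ℕ) :
    S.node (n + 1) (2 * i + 1) = S.pt n i (1 / 2) (S.slope n i / 2) := by
  have h : (2 * i + 1) / 2 = i := by omega
  simp [node, pt, h]

theorem pt_zero (n i : ℕ) : S.pt n i 0 0 = S.node n i := frame_zero _ _ _

theorem pt_one (n i : ℕ) : S.pt n i 1 0 = S.node n (i + 1) := frame_one _ _ _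

/-- The change of coordinates from a cap to the first cap built inside it. -/
theorem pt_succ_even (n i : ℕ) (x y : ℝ) :
    S.pt (n + 1) (2 * i) x y =
      S.pt n i ((x + S.slope n i * y) / 2) ((S.slope n i * x - y) / 2) := by
  have hs := neg_one_pow_mul_self n
  rw [pt, node_succ_even, node_succ_odd, pt, pt, pow_succ]
  apply plane_ext
  · simp only [frame_apply_zero, frame_apply_one]
    linear_combination (S.slope n i * y / 2 * ((S.node n (i + 1)) 0 - (S.node n i) 0)) * hs
  · simp only [frame_apply_zero, frame_apply_one]
    linear_combination (S.slope n i * y / 2 * ((S.node n (i + 1)) 1 - (S.node n i) 1)) * hs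

/-- The change of coordinates from a cap to the second cap built inside it. -/
theorem pt_succ_odd (n i : ℕ) (x y : ℝ) :
    S.pt (n + 1) (2 * i + 1) x y =
      S.pt n i (1 / 2 + (x - S.slope n i * y) / 2)
        ((S.slope n i - S.slope n i * x - y) / 2) := by
  have hs := neg_one_pow_mul_self n
  rw [pt, show 2 * i + 1 + 1 = 2 * (i + 1) by ring, node_succ_even, node_succ_odd, pt, pt, pow_succ]
  apply plane_ext
  · simp only [frame_apply_zero, frame_apply_one]
    linear_combination -(S.slope n i * y / 2 * ((S.node n (i + 1)) 0 - (S.node n i) 0)) * hs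
  · simp only [frame_apply_zero, frame_apply_one]
    linear_combination -(S.slope n i * y / 2 * ((S.node n (i + 1)) 1 - (S.node n i) 1)) * hs

theorem dist_pt (n i : ℕ) (x y x' y' : ℝ) :
    dist (S.pt n i x y) (S.pt n i x' y') = S.len n i * √((x - x') ^ 2 + (y - y') ^ 2) :=
  dist_frame (neg_one_pow_mul_self n) _ _ _ _ _ _

theorem len_nonneg (n i : ℕ) : 0 ≤ S.len n i := dist_nonneg

theorem len_succ (n j : ℕ) :
    S.len (n + 1) j = S.len n (j / 2) * (√(1 + S.slope n (j / 2) ^ 2) / 2) := by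
  have h4 : √(1 + S.slope n (j / 2) ^ 2) / 2 = √((1 + S.slope n (j / 2) ^ 2) / 4) := by
    rw [Real.sqrt_div' _ (by norm_num), show (4 : ℝ) = 2 ^ 2 by norm_num,
      Real.sqrt_sq (by norm_num)]
  rw [h4, len, ← pt_zero, ← pt_one]
  obtain ⟨i, rfl | rfl⟩ := Nat.even_or_odd' j
  · rw [pt_succ_even, pt_succ_even, dist_pt, show 2 * i / 2 = i by omega]
    congr 2; ring
  · rw [pt_succ_odd, pt_succ_odd, dist_pt, show (2 * i + 1) / 2 = i by omega]
    congr 2; ring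

theorem len_succ_le (n j : ℕ) : S.len (n + 1) j ≤ 3 / 4 * S.len n (j / 2) := by
  have h := S.slope_le n (j / 2)
  have h0 := S.slope_nonneg n (j / 2)
  have : √(1 + S.slope n (j / 2) ^ 2) ≤ 3 / 2 := by
    rw [Real.sqrt_le_left (by norm_num)]; nlinarith
  rw [len_succ]
  nlinarith [S.len_nonneg n (j / 2)]

theorem len_le (n j : ℕ) : S.len n j ≤ (3 / 4) ^ n * dist S.a S.b := by
  induction n generalizing j with
  | zero =>
    rcases j with _ | j
    · simp [len, node]
    · simp [len, node]
  | succ n ih =>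
    calc _ ≤ 3 / 4 * S.len n (j / 2) := S.len_succ_le n j
      _ ≤ 3 / 4 * ((3 / 4) ^ n * dist S.a S.b) := by gcongr; exact ih _
      _ = _ := by ring

theorem len_pos {n j : ℕ} (h : j < 2 ^ n) : 0 < S.len n j := by
  induction n generalizing j with
  | zero =>
    obtain rfl : j = 0 := by simpa using h
    simpa [len, node] using S.a_ne_b
  | succ n ih =>
    rw [len_succ]
    have := ih (j := j / 2) (by rw [pow_succ] at h; omega)
    positivity

/-- The triangular cap on the segment number `i` of stage `n`. -/
def cap (n i : ℕ) : Set Plane := {p | ∃ x y, (x, y) ∈ triangle (S.slope n i) ∧ p = S.pt n i x y}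

theorem isClosed_cap (n i : ℕ) : IsClosed (S.cap n i) := by
  have : S.cap n i = (fun p : ℝ × ℝ => S.pt n i p.1 p.2) '' triangle (S.slope n i) := by
    ext p
    simp [cap, eq_comm]
  rw [this]
  refine ((isCompact_triangle (S.slope_nonneg n i)).image ?_).isClosed
  unfold pt frame
  fun_prop

theorem node_mem_cap (n i : ℕ) : S.node n i ∈ S.cap n i :=
  ⟨0, 0, by simpa [triangle] using S.slope_nonneg n i, (S.pt_zero n i).symm⟩

theorem node_succ_mem_cap (n i : ℕ) : S.node n (i + 1) ∈ S.cap n i :=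
  ⟨1, 0, by simpa [triangle] using S.slope_nonneg n i, (S.pt_one n i).symm⟩

theorem dist_le_len {n i : ℕ} {p q : Plane} (hp : p ∈ S.cap n i) (hq : q ∈ S.cap n i) :
    dist p q ≤ S.len n i := by
  obtain ⟨x, y, h, rfl⟩ := hp
  obtain ⟨x', y', h', rfl⟩ := hq
  rw [dist_pt]
  refine mul_le_of_le_one_right (S.len_nonneg n i) (Real.sqrt_le_one.2 ?_)
  exact triangle_diam ((S.slope_le n i).trans (by norm_num)) h h'

/-- A point of the first cap inside a cap lies in the first half of the latter, strictly unless
it is the apex; this needs base angles of less than `45` degrees. -/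
theorem exists_of_mem_cap_even {n i : ℕ} {p : Plane} (hp : p ∈ S.cap (n + 1) (2 * i)) :
    ∃ x y, (x, y) ∈ triangle (S.slope n i) ∧ p = S.pt n i x y ∧ x ≤ 1 / 2 ∧
      (x = 1 / 2 → p = S.node (n + 1) (2 * i + 1)) := by
  obtain ⟨x, y, ⟨hx0, hx1, hy0, hy1, hy2⟩, rfl⟩ := hp
  have hle := S.slope_succ_le n (2 * i)
  rw [show (2 * i) / 2 = i by omega] at hle
  have ht := S.slope_le n i
  have h0 := S.slope_nonneg n i
  simp only at hx0 hx1 hy0 hy1 hy2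
  set t := S.slope n i with htdef
  have h1 : y ≤ t * x := hy1.trans (by gcongr)
  have h2 : y ≤ t * (1 - x) := hy2.trans (by gcongr)
  have h3 : t * y ≤ (1 - x) / 4 := by nlinarith
  have h4 : 0 ≤ t * y := by positivity
  have h5 : t * (t * y) ≤ 1 / 2 * (t * y) := by gcongr
  refine ⟨(x + t * y) / 2, (t * x - y) / 2, ⟨?_, ?_, ?_, ?_, ?_⟩, S.pt_succ_even n i x y, ?_, ?_⟩
  all_goals try simp only
  · linarith
  · linarith
  · linarith
  · nlinarith
  · nlinarith
  · linarith
  · intro h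
    obtain rfl : x = 1 := by linarith
    obtain rfl : y = 0 := by linarith
    exact S.pt_one _ _

/-- A point of the second cap inside a cap lies in the second half of the latter, strictly unless
it is the apex. -/
theorem exists_of_mem_cap_odd {n i : ℕ} {p : Plane} (hp : p ∈ S.cap (n + 1) (2 * i + 1)) :
    ∃ x y, (x, y) ∈ triangle (S.slope n i) ∧ p = S.pt n i x y ∧ 1 / 2 ≤ x ∧
      (x = 1 / 2 → p = S.node (n + 1) (2 * i + 1)) := by
  obtain ⟨x, y, ⟨hx0, hx1, hy0, hy1, hy2⟩, rfl⟩ := hp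
  have hle := S.slope_succ_le n (2 * i + 1)
  rw [show (2 * i + 1) / 2 = i by omega] at hle
  have ht := S.slope_le n i
  have h0 := S.slope_nonneg n i
  simp only at hx0 hx1 hy0 hy1 hy2
  set t := S.slope n i with htdef
  have h1 : y ≤ t * x := hy1.trans (by gcongr)
  have h2 : y ≤ t * (1 - x) := hy2.trans (by gcongr)
  have h3 : t * y ≤ x / 4 := by nlinarith
  have h4 : 0 ≤ t * y := by positivity
  have h5 : t * (t * y) ≤ 1 / 2 * (t * y) := by gcongr
  refine ⟨1 / 2 + (x - t * y) / 2, (t - t * x - y) / 2, ⟨?_, ?_, ?_, ?_, ?_⟩,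
    S.pt_succ_odd n i x y, ?_, ?_⟩
  all_goals try simp only
  · linarith
  · linarith
  · linarith
  · nlinarith
  · nlinarith
  · linarith
  · intro h
    obtain rfl : x = 0 := by linarith
    obtain rfl : y = 0 := by linarith
    exact S.pt_zero _ _

theorem cap_succ_subset (n j : ℕ) : S.cap (n + 1) j ⊆ S.cap n (j / 2) := by
  intro p hp
  obtain ⟨i, rfl | rfl⟩ := Nat.even_or_odd' j
  · obtain ⟨x, y, h, h', -⟩ := S.exists_of_mem_cap_even hp
    rw [show 2 * i / 2 = i by omega]
    exact ⟨x, y, h, h'⟩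
  · obtain ⟨x, y, h, h', -⟩ := S.exists_of_mem_cap_odd hp
    rw [show (2 * i + 1) / 2 = i by omega]
    exact ⟨x, y, h, h'⟩

theorem pt_inj {n i : ℕ} (hi : i < 2 ^ n) {x y x' y' : ℝ} (h : S.pt n i x y = S.pt n i x' y') :
    x = x' ∧ y = y' := by
  have h1 := S.dist_pt n i x y x' y'
  rw [h, dist_self, zero_eq_mul, or_iff_right (S.len_pos hi).ne', Real.sqrt_eq_zero (by positivity)]
    at h1
  constructor <;> nlinarith [sq_nonneg (x - x'), sq_nonneg (y - y')]

/-- Two different caps of the same stage meet at most in a common end point of their bases. -/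
theorem eq_of_mem_cap_of_lt {n i j : ℕ} (hij : i < j) (hj : j < 2 ^ n) {p : Plane}
    (hi' : p ∈ S.cap n i) (hj' : p ∈ S.cap n j) : j = i + 1 ∧ p = S.node n j := by
  induction n generalizing i j with
  | zero => simp at hj; omega
  | succ n ih =>
    have hj2 : j / 2 < 2 ^ n := by rw [pow_succ] at hj; omega
    rcases (Nat.div_le_div_right hij.le : i / 2 ≤ j / 2).eq_or_lt with h | h
    · obtain ⟨k, hk⟩ : ∃ k, i = 2 * k := ⟨i / 2, by omega⟩
      obtain rfl : j = 2 * k + 1 := by omega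
      subst hk
      rw [show (2 * k + 1) / 2 = k by omega] at hj2
      obtain ⟨x, y, -, h1, h2, h3⟩ := S.exists_of_mem_cap_even hi'
      obtain ⟨x', y', -, h1', h2', -⟩ := S.exists_of_mem_cap_odd hj'
      have := (S.pt_inj hj2 (h1.symm.trans h1')).1
      exact ⟨rfl, h3 (by linarith)⟩
    · obtain ⟨h1, h2⟩ := ih h hj2 (S.cap_succ_subset n i hi') (S.cap_succ_subset n j hj')
      have hi2 : i / 2 < 2 ^ n := by omega
      have hjev : j = 2 * (j / 2) := by
        by_contra hne
        have h3 : j = 2 * (j / 2) + 1 := by omega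
        rw [h3] at hj'
        obtain ⟨x, y, -, h4, h5, -⟩ := S.exists_of_mem_cap_odd hj'
        rw [h2, ← pt_zero] at h4
        have := (S.pt_inj hj2 h4).1
        linarith
      have hiodd : i = 2 * (i / 2) + 1 := by
        by_contra hne
        have h3 : i = 2 * (i / 2) := by omega
        rw [h3] at hi'
        obtain ⟨x, y, -, h4, h5, -⟩ := S.exists_of_mem_cap_even hi'
        rw [h2, h1, ← pt_one] at h4
        have := (S.pt_inj hi2 h4).1
        linarith
      refine ⟨by omega, ?_⟩
      rw [h2, hjev, node_succ_even]
      congr 1; omega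

end SlopeTree

/-! ### Dyadic parametrization of the limit curve -/

/-- The number of the dyadic interval `[i / 2 ^ n, (i + 1) / 2 ^ n)` of order `n` that contains
`t ≥ 0`. -/
def dyadicIndex (n : ℕ) (t : ℝ) : ℕ := ⌊2 ^ n * t⌋₊

theorem dyadicIndex_succ_div (n : ℕ) (t : ℝ) : dyadicIndex (n + 1) t / 2 = dyadicIndex n t := by
  rw [dyadicIndex, dyadicIndex, ← Nat.floor_div_ofNat]
  congr 1
  rw [pow_succ]
  ring

theorem dyadicIndex_eq_iff {n i : ℕ} {t : ℝ} (ht : 0 ≤ t) :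
    dyadicIndex n t = i ↔ (i : ℝ) / 2 ^ n ≤ t ∧ t < (i + 1) / 2 ^ n := by
  rw [dyadicIndex, Nat.floor_eq_iff (by positivity), div_le_iff₀' (by positivity),
    lt_div_iff₀' (by positivity)]

theorem dyadicIndex_lt {n : ℕ} {t : ℝ} (ht : t < 1) : dyadicIndex n t < 2 ^ n := by
  rw [dyadicIndex, Nat.floor_lt' (by positivity)]
  push_cast
  exact mul_lt_of_lt_one_right (by positivity) ht

theorem measurable_dyadicIndex (n : ℕ) : Measurable (dyadicIndex n) :=
  Nat.measurable_floor.comp (measurable_const_mul _)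

/-- The numbers `k / 2 ^ n`. -/
def dyadics : Set ℝ := Set.range fun p : ℕ × ℕ => (p.2 : ℝ) / 2 ^ p.1

theorem countable_dyadics : dyadics.Countable := Set.countable_range _

theorem div_mem_dyadics (n k : ℕ) : (k : ℝ) / 2 ^ n ∈ dyadics := ⟨(n, k), rfl⟩

namespace SlopeTree

variable (S : SlopeTree)

/-- The limit curve, run through in such a way that the `2 ^ n` segments of every stage `n` take
the same time. -/
def curve (t : ℝ) : Plane := limUnder atTop fun n => S.node n (dyadicIndex n t)

theorem cap_dyadicIndex_subset {m n : ℕ} (h : n ≤ m) (t : ℝ) :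
    S.cap m (dyadicIndex m t) ⊆ S.cap n (dyadicIndex n t) := by
  induction m, h using Nat.le_induction with
  | base => rfl
  | succ m _ ih =>
    refine (S.cap_succ_subset m _).trans ?_
    rwa [dyadicIndex_succ_div]

theorem dist_node_dyadicIndex (n : ℕ) (t : ℝ) :
    dist (S.node n (dyadicIndex n t)) (S.node (n + 1) (dyadicIndex (n + 1) t)) ≤
      dist S.a S.b * (3 / 4) ^ n := by
  rw [mul_comm]
  exact (S.dist_le_len (S.node_mem_cap _ _)
    (S.cap_dyadicIndex_subset n.le_succ t (S.node_mem_cap _ _))).trans (S.len_le _ _)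

theorem tendsto_curve (t : ℝ) :
    Tendsto (fun n => S.node n (dyadicIndex n t)) atTop (𝓝 (S.curve t)) :=
  (cauchySeq_of_le_geometric (3 / 4) (dist S.a S.b) (by norm_num)
    (fun n => S.dist_node_dyadicIndex n t)).tendsto_limUnder

theorem curve_mem_cap (n : ℕ) (t : ℝ) : S.curve t ∈ S.cap n (dyadicIndex n t) := by
  refine (S.isClosed_cap _ _).mem_of_tendsto (S.tendsto_curve t) ?_
  filter_upwards [eventually_ge_atTop n] with m hm
  exact S.cap_dyadicIndex_subset hm t (S.node_mem_cap _ _)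

theorem tendsto_geometric_mul (C : ℝ) :
    Tendsto (fun n : ℕ => (3 / 4 : ℝ) ^ n * C) atTop (𝓝 0) := by
  simpa using (tendsto_pow_atTop_nhds_zero_of_lt_one (r := (3 / 4 : ℝ)) (by norm_num)
    (by norm_num)).mul_const C

theorem tendsto_curve_of_mem_cap {t : ℝ} {p : ℕ → Plane}
    (hp : ∀ n, p n ∈ S.cap n (dyadicIndex n t)) : Tendsto p atTop (𝓝 (S.curve t)) := by
  rw [tendsto_iff_dist_tendsto_zero]
  exact squeeze_zero (fun _ => dist_nonneg)
    (fun n => (S.dist_le_len (hp n) (S.curve_mem_cap n t)).trans (S.len_le _ _))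
    (tendsto_geometric_mul _)

theorem node_add_mul (n m k : ℕ) : S.node (n + m) (k * 2 ^ m) = S.node n k := by
  induction m with
  | zero => simp
  | succ m ih =>
    rw [← add_assoc, show k * 2 ^ (m + 1) = 2 * (k * 2 ^ m) by ring, node_succ_even, ih]

/-- At dyadic times the curve passes through the vertices, which stay where they are from the stage
at which they arise. -/
theorem curve_div (n k : ℕ) : S.curve (k / 2 ^ n) = S.node n k := by
  refine tendsto_nhds_unique ((tendsto_add_atTop_iff_nat n).2 (S.tendsto_curve _)) ?_
  refine tendsto_const_nhds.congr fun m => ?_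
  have : dyadicIndex (m + n) (k / 2 ^ n) = k * 2 ^ m := by
    have h : (2 : ℝ) ^ m * 2 ^ n * (k / 2 ^ n) = ((k * 2 ^ m : ℕ) : ℝ) := by
      push_cast; field_simp
    rw [dyadicIndex, pow_add, h, Nat.floor_natCast]
  rw [this, add_comm, node_add_mul]

/-- At two times at most `2⁻ⁿ` apart, the curve is in the same cap of stage `n` or in two caps with
a common vertex. -/
theorem dist_curve_le {n : ℕ} {s t : ℝ} (hst : s ≤ t) (h : t ≤ s + 1 / 2 ^ n) :
    dist (S.curve s) (S.curve t) ≤ (3 / 4) ^ n * (2 * dist S.a S.b) := by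
  have h1 : dyadicIndex n s ≤ dyadicIndex n t := Nat.floor_le_floor (by gcongr)
  have h2 : dyadicIndex n t ≤ dyadicIndex n s + 1 := by
    rcases le_total 0 s with hs | hs
    · rw [dyadicIndex, dyadicIndex, ← Nat.floor_add_one (by positivity)]
      refine Nat.floor_le_floor ?_
      calc (2 : ℝ) ^ n * t ≤ 2 ^ n * (s + 1 / 2 ^ n) := by gcongr
        _ = _ := by field_simp
    · refine (Nat.floor_le_floor (b := (1 : ℝ)) ?_).trans (by simp)
      calc (2 : ℝ) ^ n * t ≤ 2 ^ n * (0 + 1 / 2 ^ n) := by gcongr; linarith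
        _ = _ := by field_simp; simp
  have hl := S.len_le n
  have hs := S.curve_mem_cap n s
  have ht := S.curve_mem_cap n t
  have h0 : 0 ≤ (3 / 4) ^ n * dist S.a S.b := by positivity
  obtain h3 | h3 : dyadicIndex n t = dyadicIndex n s ∨ dyadicIndex n t = dyadicIndex n s + 1 := by
    omega
  · rw [h3] at ht
    linarith [S.dist_le_len hs ht, hl (dyadicIndex n s)]
  · rw [h3] at ht
    linarith [S.dist_le_len hs (S.node_succ_mem_cap _ _), S.dist_le_len (S.node_mem_cap _ _) ht,
      hl (dyadicIndex n s), hl (dyadicIndex n s + 1),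
      dist_triangle (S.curve s) (S.node n (dyadicIndex n s + 1)) (S.curve t)]

theorem continuous_curve : Continuous S.curve := by
  rw [Metric.continuous_iff]
  intro t e he
  obtain ⟨n, hn⟩ := ((tendsto_geometric_mul (2 * dist S.a S.b)).eventually
    (gt_mem_nhds he)).exists
  refine ⟨1 / 2 ^ n, by positivity, fun s hs => ?_⟩
  rw [Real.dist_eq, abs_lt] at hs
  rcases le_total s t with h | h
  · exact (S.dist_curve_le h (by linarith)).trans_lt hn
  · rw [dist_comm]
    exact (S.dist_curve_le h (by linarith)).trans_lt hn

theorem exists_dyadicIndex_add_two_le {s t : ℝ} (hs : 0 ≤ s) (hst : s < t) :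
    ∃ n, dyadicIndex n s + 2 ≤ dyadicIndex n t := by
  obtain ⟨n, hn⟩ := pow_unbounded_of_one_lt (2 / (t - s)) (one_lt_two (α := ℝ))
  rw [div_lt_iff₀ (by linarith)] at hn
  refine ⟨n, ?_⟩
  rw [dyadicIndex, dyadicIndex, ← Nat.floor_add_ofNat (by positivity)]
  refine Nat.floor_le_floor ?_
  linarith

theorem injOn_curve : Set.InjOn S.curve (Set.Ico 0 1) := by
  intro s hs t ht h
  by_contra hne
  wlog hst : s < t generalizing s t
  · exact this ht hs h.symm (Ne.symm hne) (lt_of_le_of_ne (not_lt.1 hst) (Ne.symm hne))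
  obtain ⟨n, hn⟩ := exists_dyadicIndex_add_two_le hs.1 hst
  have h1 := S.curve_mem_cap n s
  rw [h] at h1
  have := (S.eq_of_mem_cap_of_lt (by omega) (dyadicIndex_lt ht.2) h1 (S.curve_mem_cap n t)).1
  omega

/-- A point of the limit curve whose time is not dyadic is not a vertex. -/
theorem curve_ne_node {t : ℝ} (ht : t ∈ Set.Ico (0 : ℝ) 1) (htd : t ∉ dyadics) {n k : ℕ}
    (hk : k ≤ 2 ^ n) : S.curve t ≠ S.node n k := by
  intro h
  rcases hk.lt_or_eq with hk | rfl
  · rw [← curve_div] at h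
    have hk' : (k : ℝ) / 2 ^ n ∈ Set.Ico (0 : ℝ) 1 := by
      refine ⟨by positivity, ?_⟩
      rw [div_lt_one (by positivity)]
      exact_mod_cast hk
    exact htd (S.injOn_curve ht hk' h ▸ div_mem_dyadics n k)
  · -- The last vertex is the end point of the last cap of every stage.
    obtain ⟨m, hm⟩ := exists_dyadicIndex_add_two_le ht.1 ht.2
    have h1 : dyadicIndex m 1 = 2 ^ m := by
      rw [dyadicIndex, mul_one, show (2 : ℝ) ^ m = ((2 ^ m : ℕ) : ℝ) by push_cast; rfl,
        Nat.floor_natCast]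
    have h2 : S.node m (2 ^ m - 1 + 1) = S.node n (2 ^ n) := by
      rw [Nat.sub_add_cancel Nat.one_le_two_pow, ← curve_div, ← curve_div]
      congr 1
      push_cast
      rw [div_self (by positivity), div_self (by positivity)]
    have h3 := S.node_succ_mem_cap m (2 ^ m - 1)
    rw [h2, ← h] at h3
    have := (S.eq_of_mem_cap_of_lt (i := dyadicIndex m t) (j := 2 ^ m - 1) (by omega)
      (by omega) (S.curve_mem_cap m t) h3).2
    rw [← curve_div] at this
    have hk' : ((2 ^ m - 1 : ℕ) : ℝ) / 2 ^ m ∈ Set.Ico (0 : ℝ) 1 := by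
      refine ⟨by positivity, ?_⟩
      rw [div_lt_one (by positivity)]
      exact_mod_cast Nat.sub_lt (by positivity) one_pos
    exact htd (S.injOn_curve ht hk' this ▸ div_mem_dyadics m _)

theorem eq_of_curve_mem_cap {t : ℝ} (ht : t ∈ Set.Ico (0 : ℝ) 1) (htd : t ∉ dyadics) {n i : ℕ}
    (hi : i < 2 ^ n) (h : S.curve t ∈ S.cap n i) : i = dyadicIndex n t := by
  have h1 := S.curve_mem_cap n t
  have h2 := dyadicIndex_lt (n := n) ht.2
  rcases lt_trichotomy i (dyadicIndex n t) with h3 | h3 | h3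
  · exact absurd (S.eq_of_mem_cap_of_lt h3 h2 h h1).2 (S.curve_ne_node ht htd h2.le)
  · exact h3
  · exact absurd (S.eq_of_mem_cap_of_lt h3 hi h1 h).2 (S.curve_ne_node ht htd hi.le)

/-- The factor by which the segment number `i` of stage `n` is longer than the `2 ^ n`-th part of
the base: the product of the secants of the base angles of the caps that it comes from. -/
def weight : ℕ → ℕ → ℝ
  | 0, _ => 1
  | n + 1, i => weight n (i / 2) * √(1 + S.slope n (i / 2) ^ 2)

theorem one_le_weight (n i : ℕ) : 1 ≤ S.weight n i := by
  induction n generalizing i with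
  | zero => exact le_rfl
  | succ n ih =>
    refine one_le_mul_of_one_le_of_one_le (ih _) (Real.one_le_sqrt.2 ?_)
    linarith [sq_nonneg (S.slope n (i / 2))]

theorem weight_le_weight_succ (n i : ℕ) : S.weight n (i / 2) ≤ S.weight (n + 1) i := by
  refine le_mul_of_one_le_right (zero_le_one.trans (S.one_le_weight _ _)) (Real.one_le_sqrt.2 ?_)
  linarith [sq_nonneg (S.slope n (i / 2))]

theorem len_eq {n i : ℕ} (hi : i < 2 ^ n) : S.len n i = dist S.a S.b * S.weight n i / 2 ^ n := by
  induction n generalizing i with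
  | zero =>
    obtain rfl : i = 0 := by simpa using hi
    simp [len, node, weight]
  | succ n ih =>
    rw [len_succ, ih (by rw [pow_succ] at hi; omega), weight]
    field_simp
    ring

theorem monotone_weight (t : ℝ) : Monotone fun n => S.weight n (dyadicIndex n t) := by
  refine monotone_nat_of_le_succ fun n => ?_
  have := S.weight_le_weight_succ n (dyadicIndex (n + 1) t)
  rwa [dyadicIndex_succ_div] at this

/-- The infinite product of the secants of the base angles along the caps that contain the point
of the limit curve at time `t`. -/
def density (t : ℝ) : ℝ≥0∞ := ⨆ n, ENNReal.ofReal (S.weight n (dyadicIndex n t))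

theorem measurable_weight (n : ℕ) :
    Measurable fun t => ENNReal.ofReal (S.weight n (dyadicIndex n t)) :=
  (measurable_of_countable fun i => ENNReal.ofReal (S.weight n i)).comp (measurable_dyadicIndex n)

theorem measurable_density : Measurable S.density :=
  Measurable.iSup fun n => S.measurable_weight n

end SlopeTree

/-! ### The length measure of the limit curve -/

/-- The dyadic interval `[i / 2 ^ n, (i + 1) / 2 ^ n)`. -/
def dyadicIco (n i : ℕ) : Set ℝ := {t | 0 ≤ t ∧ dyadicIndex n t = i}

theorem dyadicIco_eq (n i : ℕ) : dyadicIco n i = Set.Ico ((i : ℝ) / 2 ^ n) ((i + 1) / 2 ^ n) := by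
  ext t
  constructor
  · rintro ⟨h0, h⟩
    exact (dyadicIndex_eq_iff h0).1 h
  · intro h
    have h0 : 0 ≤ t := le_trans (by positivity) h.1
    exact ⟨h0, (dyadicIndex_eq_iff h0).2 h⟩

theorem measurableSet_dyadicIco (n i : ℕ) : MeasurableSet (dyadicIco n i) := by
  rw [dyadicIco_eq]; exact measurableSet_Ico

theorem volume_dyadicIco (n i : ℕ) : volume (dyadicIco n i) = ENNReal.ofReal (1 / 2 ^ n) := by
  rw [dyadicIco_eq, Real.volume_Ico, ← sub_div]
  simp

theorem dyadicIco_subset {n i : ℕ} (hi : i < 2 ^ n) : dyadicIco n i ⊆ Set.Ico 0 1 := by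
  rintro t ⟨h0, h⟩
  refine ⟨h0, ((dyadicIndex_eq_iff h0).1 h).2.trans_le ?_⟩
  rw [div_le_one (by positivity)]
  exact_mod_cast hi

theorem pairwiseDisjoint_dyadicIco (n : ℕ) (s : Set ℕ) : s.PairwiseDisjoint (dyadicIco n) :=
  fun _ _ _ _ hij => Set.disjoint_left.2 fun _ h h' => hij (h.2.symm.trans h'.2)

theorem biUnion_dyadicIco (n : ℕ) :
    ⋃ i ∈ Finset.range (2 ^ n), dyadicIco n i = Set.Ico (0 : ℝ) 1 := by
  ext t
  simp only [Set.mem_iUnion, Finset.mem_range, exists_prop]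
  constructor
  · rintro ⟨i, hi, h⟩
    exact dyadicIco_subset hi h
  · intro h
    exact ⟨dyadicIndex n t, dyadicIndex_lt h.2, h.1, rfl⟩

theorem dyadicIco_union (n i : ℕ) :
    dyadicIco (n + 1) (2 * i) ∪ dyadicIco (n + 1) (2 * i + 1) = dyadicIco n i := by
  ext t
  simp only [dyadicIco, Set.mem_union, Set.mem_ofPred_eq, ← dyadicIndex_succ_div n t]
  rw [← and_or_left]
  refine and_congr_right fun _ => ?_
  omega

/-- A finite measure on `[0, 1)` that dominates another one of the same mass on the dyadic
intervals is equal to it. -/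
theorem eq_of_le_dyadicIco {μ ν : Measure ℝ} (hμ : μ (Set.Ico 0 1)ᶜ = 0)
    (hν : ν (Set.Ico 0 1)ᶜ = 0) (hfin : μ Set.univ ≠ ∞) (huniv : ν Set.univ ≤ μ Set.univ)
    (h : ∀ n i, i < 2 ^ n → μ (dyadicIco n i) ≤ ν (dyadicIco n i)) : μ = ν := by
  have key (ρ : Measure ℝ) (hρ : ρ (Set.Ico 0 1)ᶜ = 0) (n : ℕ) :
      ρ Set.univ = ∑ i ∈ Finset.range (2 ^ n), ρ (dyadicIco n i) := by
    rw [← measure_biUnion_finset (pairwiseDisjoint_dyadicIco n _)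
      (fun i _ => measurableSet_dyadicIco n i), biUnion_dyadicIco,
      ← measure_add_measure_compl (measurableSet_Ico (a := (0 : ℝ)) (b := 1)), hρ, add_zero]
  have heq (n i : ℕ) (hi : i < 2 ^ n) : μ (dyadicIco n i) = ν (dyadicIco n i) := by
    refine (h n i hi).antisymm ?_
    have h1 := huniv
    rw [key μ hμ n, key ν hν n, ← Finset.add_sum_erase _ _ (Finset.mem_range.2 hi),
      ← Finset.add_sum_erase _ _ (Finset.mem_range.2 hi)] at h1
    have h2 : ∑ j ∈ (Finset.range (2 ^ n)).erase i, μ (dyadicIco n j) ≤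
        ∑ j ∈ (Finset.range (2 ^ n)).erase i, ν (dyadicIco n j) :=
      Finset.sum_le_sum fun j hj => h n j (Finset.mem_range.1 (Finset.mem_of_mem_erase hj))
    have h3 : ∑ j ∈ (Finset.range (2 ^ n)).erase i, μ (dyadicIco n j) ≠ ∞ := by
      refine ne_top_of_le_ne_top hfin ?_
      rw [key μ hμ n]
      exact Finset.sum_le_sum_of_subset (Finset.erase_subset _ _)
    exact (ENNReal.add_le_add_iff_right h3).1 ((add_le_add_right h2 _).trans h1)
  have : IsFiniteMeasure μ := ⟨hfin.lt_top⟩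
  have huniv' : μ Set.univ = ν Set.univ := by
    rw [key μ hμ 0, key ν hν 0]
    exact Finset.sum_congr rfl fun i hi => heq 0 i (Finset.mem_range.1 hi)
  refine ext_of_generate_finite _
    ((BorelSpace.measurable_eq (α := ℝ)).trans (borel_eq_generateFrom_Iio ℝ)) isPiSystem_Iio ?_
    huniv'
  rintro _ ⟨a, rfl⟩
  -- `s n` is the union of the dyadic intervals of order `n` that lie to the left of `a`.
  let s (n : ℕ) : Set ℝ :=
    ⋃ i ∈ (Finset.range (2 ^ n)).filter (fun i : ℕ => ((i : ℝ) + 1) / 2 ^ n ≤ a), dyadicIco n i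
  have hmem (n : ℕ) (t : ℝ) :
      t ∈ s n ↔ t ∈ Set.Ico (0 : ℝ) 1 ∧ ((dyadicIndex n t : ℝ) + 1) / 2 ^ n ≤ a := by
    simp only [s, Set.mem_iUnion, Finset.mem_filter, Finset.mem_range, exists_prop]
    constructor
    · rintro ⟨i, ⟨hi, hia⟩, hit⟩
      refine ⟨dyadicIco_subset hi hit, ?_⟩
      rwa [hit.2]
    · rintro ⟨h1, h2⟩
      exact ⟨_, ⟨dyadicIndex_lt h1.2, h2⟩, h1.1, rfl⟩
  have hmono : Monotone s := by
    refine monotone_nat_of_le_succ fun n t ht => ?_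
    rw [hmem] at ht ⊢
    refine ⟨ht.1, le_trans ?_ ht.2⟩
    have h1 : dyadicIndex (n + 1) t + 1 ≤ 2 * (dyadicIndex n t + 1) := by
      have := dyadicIndex_succ_div n t
      omega
    have h2 : (dyadicIndex (n + 1) t : ℝ) + 1 ≤ 2 * (dyadicIndex n t + 1) := by exact_mod_cast h1
    rw [pow_succ, div_le_div_iff₀ (by positivity) (by positivity)]
    nlinarith [pow_pos (two_pos (α := ℝ)) n]
  have hUnion : ⋃ n, s n = Set.Iio a ∩ Set.Ico 0 1 := by
    ext t
    simp only [Set.mem_iUnion, hmem]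
    constructor
    · rintro ⟨n, h1, h2⟩
      exact ⟨((dyadicIndex_eq_iff h1.1).1 (rfl : dyadicIndex n t = _)).2.trans_le h2, h1⟩
    · rintro ⟨h1, h2⟩
      obtain ⟨n, hn⟩ := pow_unbounded_of_one_lt (1 / (a - t)) (one_lt_two (α := ℝ))
      rw [div_lt_iff₀ (by linarith [Set.mem_Iio.1 h1])] at hn
      refine ⟨n, h2, ?_⟩
      have h3 := ((dyadicIndex_eq_iff h2.1).1 (rfl : dyadicIndex n t = _)).1
      rw [div_le_iff₀ (by positivity)] at h3 ⊢
      nlinarith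
  have hs (n : ℕ) : μ (s n) = ν (s n) := by
    rw [measure_biUnion_finset (pairwiseDisjoint_dyadicIco n _)
      (fun i _ => measurableSet_dyadicIco n i), measure_biUnion_finset
      (pairwiseDisjoint_dyadicIco n _) (fun i _ => measurableSet_dyadicIco n i)]
    exact Finset.sum_congr rfl fun i hi =>
      heq n i (Finset.mem_range.1 (Finset.mem_filter.1 hi).1)
  have hsub : Set.Iio a \ Set.Ico 0 1 ⊆ (Set.Ico (0 : ℝ) 1)ᶜ := fun t ht => ht.2
  rw [← measure_inter_add_sdiff (Set.Iio a) (measurableSet_Ico (a := (0 : ℝ)) (b := 1)),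
    ← measure_inter_add_sdiff (μ := ν) (Set.Iio a) (measurableSet_Ico (a := (0 : ℝ)) (b := 1)),
    measure_mono_null hsub hμ, measure_mono_null hsub hν, ← hUnion]
  congr 1
  refine tendsto_nhds_unique (tendsto_measure_iUnion_atTop hmono) ?_
  refine (tendsto_measure_iUnion_atTop hmono).congr fun n => ?_
  exact (hs n).symm

namespace SlopeTree

variable (S : SlopeTree)

/-- The length measure of the limit curve, transported to the times in `[0, 1)`. -/
def curveMeasure : Measure ℝ :=
  ((Measure.hausdorffMeasure 1 : Measure Plane).comap ((Set.Ico (0 : ℝ) 1).domRestrict S.curve)).map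
    Subtype.val

theorem curveMeasure_apply (s : Set ℝ) :
    S.curveMeasure s =
      (Measure.hausdorffMeasure 1 : Measure Plane) (S.curve '' (s ∩ Set.Ico 0 1)) := by
  rw [curveMeasure, (MeasurableEmbedding.subtype_coe measurableSet_Ico).map_apply,
    (S.continuous_curve.continuousOn.measurableEmbedding measurableSet_Ico
      S.injOn_curve).comap_apply]
  congr 1
  ext p
  simp only [Set.mem_image, Set.mem_preimage, Subtype.exists, Set.domRestrict_apply,
    Set.mem_inter_iff]
  grind

/-- The measure that the area formula predicts for the length of the curve: its density with
respect to Lebesgue measure is the length of the base times the infinite product. -/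
def stretchMeasure : Measure ℝ :=
  ENNReal.ofReal (dist S.a S.b) • (volume.restrict (Set.Ico 0 1)).withDensity S.density

theorem stretchMeasure_apply {s : Set ℝ} (hs : MeasurableSet s) (h : s ⊆ Set.Ico 0 1) :
    S.stretchMeasure s = ENNReal.ofReal (dist S.a S.b) * ∫⁻ t in s, S.density t := by
  rw [stretchMeasure, Measure.smul_apply, withDensity_apply _ hs,
    Measure.restrict_restrict hs, Set.inter_eq_left.2 h, smul_eq_mul]

theorem lintegral_weight {n i : ℕ} (hi : i < 2 ^ n) :
    ENNReal.ofReal (dist S.a S.b) *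
        ∫⁻ t in dyadicIco n i, ENNReal.ofReal (S.weight n (dyadicIndex n t)) =
      ENNReal.ofReal (S.len n i) := by
  have : ∫⁻ t in dyadicIco n i, ENNReal.ofReal (S.weight n (dyadicIndex n t)) =
      ∫⁻ _ in dyadicIco n i, ENNReal.ofReal (S.weight n i) :=
    setLIntegral_congr_fun (measurableSet_dyadicIco n i) fun t ht => by simp only [ht.2]
  rw [this, lintegral_const, Measure.restrict_apply_univ, volume_dyadicIco,
    ← ENNReal.ofReal_mul (zero_le_one.trans (S.one_le_weight n i)),
    ← ENNReal.ofReal_mul dist_nonneg, S.len_eq hi]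
  congr 1
  ring

/-- An arc of the limit curve is at least as long as its chord. -/
theorem len_le_curveMeasure {n i : ℕ} (hi : i < 2 ^ n) :
    ENNReal.ofReal (S.len n i) ≤ S.curveMeasure (dyadicIco n i) := by
  rw [curveMeasure_apply, Set.inter_eq_left.2 (dyadicIco_subset hi)]
  have hL : LipschitzWith 1 fun p : Plane => dist p (S.node n i) := LipschitzWith.dist_left _
  have h1 : Set.Ico 0 (S.len n i) ⊆
      (fun p : Plane => dist p (S.node n i)) '' (S.curve '' dyadicIco n i) := by
    have h2 := intermediate_value_Ico (f := fun t => dist (S.curve t) (S.node n i))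
      (show (i : ℝ) / 2 ^ n ≤ ((i + 1 : ℕ) : ℝ) / 2 ^ n by gcongr; simp)
      (S.continuous_curve.dist continuous_const).continuousOn
    rw [curve_div, curve_div, dist_self, dist_comm] at h2
    rw [Set.image_image, dyadicIco_eq]
    exact_mod_cast h2
  calc ENNReal.ofReal (S.len n i) = volume (Set.Ico 0 (S.len n i)) := by simp
    _ ≤ _ := measure_mono h1
    _ ≤ _ := by
      rw [← hausdorffMeasure_real]
      simpa using hL.hausdorffMeasure_image_le zero_le_one (S.curve '' dyadicIco n i)

theorem lintegral_weight_le_curveMeasure (k : ℕ) {n i : ℕ} (hi : i < 2 ^ n) :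
    ENNReal.ofReal (dist S.a S.b) *
        ∫⁻ t in dyadicIco n i, ENNReal.ofReal (S.weight (n + k) (dyadicIndex (n + k) t)) ≤
      S.curveMeasure (dyadicIco n i) := by
  induction k generalizing n i with
  | zero =>
    rw [add_zero, S.lintegral_weight hi]
    exact S.len_le_curveMeasure hi
  | succ k ih =>
    have hd : Disjoint (dyadicIco (n + 1) (2 * i)) (dyadicIco (n + 1) (2 * i + 1)) :=
      pairwiseDisjoint_dyadicIco (n + 1) Set.univ trivial trivial (by omega)
    have hm := measurableSet_dyadicIco (n + 1) (2 * i + 1)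
    rw [← dyadicIco_union, measure_union hd hm, lintegral_union hm hd, mul_add,
      show n + (k + 1) = n + 1 + k by ring]
    exact add_le_add (ih (by rw [pow_succ]; omega)) (ih (by rw [pow_succ]; omega))

theorem stretchMeasure_le_curveMeasure {n i : ℕ} (hi : i < 2 ^ n) :
    S.stretchMeasure (dyadicIco n i) ≤ S.curveMeasure (dyadicIco n i) := by
  rw [S.stretchMeasure_apply (measurableSet_dyadicIco n i) (dyadicIco_subset hi)]
  unfold density
  rw [lintegral_iSup S.measurable_weight
    (fun m m' h t => ENNReal.ofReal_le_ofReal (S.monotone_weight t h)), ENNReal.mul_iSup]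
  refine iSup_le fun m => le_trans ?_ (S.lintegral_weight_le_curveMeasure m hi)
  gcongr
  exact S.monotone_weight _ (Nat.le_add_left m n)

/-- The limit curve is at most as long as the limit of the polygonal lines, since it is covered by
caps whose diameters are the lengths of their bases. -/
theorem curveMeasure_univ_le : S.curveMeasure Set.univ ≤ S.stretchMeasure (Set.Ico 0 1) := by
  rw [curveMeasure_apply, Set.univ_inter, S.stretchMeasure_apply measurableSet_Ico subset_rfl]
  have hcap (n i : ℕ) : Metric.ediam (S.cap n i) ≤ ENNReal.ofReal (S.len n i) :=
    Metric.ediam_le_of_forall_dist_le fun p hp q hq => S.dist_le_len hp hq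
  refine (Measure.hausdorffMeasure_le_liminf_sum (β := ℕ) (ι := fun n => Fin (2 ^ n)) (l := atTop) 1
    (S.curve '' Set.Ico 0 1) (fun n => ENNReal.ofReal ((3 / 4) ^ n * dist S.a S.b)) ?_
    (fun n i => S.cap n i) ?_ ?_).trans ?_
  · simpa using ENNReal.tendsto_ofReal (tendsto_geometric_mul (dist S.a S.b))
  · exact Eventually.of_forall fun n i =>
      (hcap n i).trans (ENNReal.ofReal_le_ofReal (S.len_le n i))
  · refine Eventually.of_forall fun n => ?_
    rintro _ ⟨t, ht, rfl⟩
    exact Set.mem_iUnion.2 ⟨⟨dyadicIndex n t, dyadicIndex_lt ht.2⟩, S.curve_mem_cap n t⟩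
  · refine liminf_le_of_le (by isBoundedDefault) fun b hb => ?_
    obtain ⟨n, hn⟩ := hb.exists
    refine hn.trans ?_
    calc ∑ i : Fin (2 ^ n), Metric.ediam (S.cap n i) ^ (1 : ℝ)
        ≤ ∑ i : Fin (2 ^ n), ENNReal.ofReal (S.len n i) :=
          Finset.sum_le_sum fun i _ => by simpa using hcap n i
      _ = ∑ i ∈ Finset.range (2 ^ n), ENNReal.ofReal (S.len n i) :=
          Fin.sum_univ_eq_sum_range (fun i => ENNReal.ofReal (S.len n i)) _
      _ = ∑ i ∈ Finset.range (2 ^ n), ENNReal.ofReal (dist S.a S.b) *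
            ∫⁻ t in dyadicIco n i, ENNReal.ofReal (S.weight n (dyadicIndex n t)) :=
          Finset.sum_congr rfl fun i hi => (S.lintegral_weight (Finset.mem_range.1 hi)).symm
      _ = ENNReal.ofReal (dist S.a S.b) *
            ∫⁻ t in Set.Ico 0 1, ENNReal.ofReal (S.weight n (dyadicIndex n t)) := by
          rw [← Finset.mul_sum, ← biUnion_dyadicIco n, lintegral_biUnion_finset
            (pairwiseDisjoint_dyadicIco n _) (fun i _ => measurableSet_dyadicIco n i)]
      _ ≤ _ := by
          gcongr with t
          exact le_iSup (fun n => ENNReal.ofReal (S.weight n (dyadicIndex n t))) n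

/-- For a limit curve of finite length in the sense of the polygonal lines, the length measure has
the expected density. -/
theorem curveMeasure_eq (h : S.stretchMeasure Set.univ ≠ ∞) :
    S.curveMeasure = S.stretchMeasure := by
  refine (eq_of_le_dyadicIco ?_ ?_ h ?_ fun n i hi => S.stretchMeasure_le_curveMeasure hi).symm
  · rw [stretchMeasure, Measure.smul_apply, withDensity_apply _ measurableSet_Ico.compl,
      Measure.restrict_restrict measurableSet_Ico.compl]
    simp
  · rw [curveMeasure_apply]
    simp
  · exact S.curveMeasure_univ_le.trans (measure_mono (Set.subset_univ _))

end SlopeTree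

/-! ### Truncated slope trees and the area formula -/

namespace SlopeTree

variable (S : SlopeTree)

theorem measurableSet_density_ne_top : MeasurableSet {t | S.density t ≠ ∞} :=
  S.measurable_density (measurableSet_singleton ∞).compl

/-- The tree that is made flat from the moment when the product of the secants would exceed `M`. -/
def truncate (M : ℝ) : SlopeTree where
  a := S.a
  b := S.b
  a_ne_b := S.a_ne_b
  slope n i := if S.weight (n + 1) (2 * i) ≤ M then S.slope n i else 0
  slope_nonneg n i := by
    split_ifs
    exacts [S.slope_nonneg n i, le_rfl]
  slope_zero_le i := by
    split_ifs
    exacts [S.slope_zero_le i, by norm_num]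
  slope_succ_le n i := by
    have h1 := S.weight_le_weight_succ (n + 1) (2 * i)
    have h2 : S.weight (n + 1) (2 * (i / 2)) = S.weight (n + 1) i := by
      simp [weight, show 2 * (i / 2) / 2 = i / 2 by omega]
    rw [show 2 * i / 2 = i by omega] at h1
    split_ifs with h3 h4 h4
    · exact S.slope_succ_le n i
    · exact absurd (h2.le.trans (h1.trans h3)) h4
    · exact S.slope_nonneg _ _
    · exact le_rfl

theorem truncate_slope {M : ℝ} {n i j : ℕ} (hij : j / 2 = i) :
    (S.truncate M).slope n i = if S.weight (n + 1) j ≤ M then S.slope n i else 0 := by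
  have : S.weight (n + 1) (2 * i) = S.weight (n + 1) j := by
    simp [weight, show 2 * i / 2 = j / 2 by omega]
  simp [truncate, this]

theorem truncate_weight {M : ℝ} (hM : 1 ≤ M) (n i : ℕ) :
    (S.truncate M).weight n i ≤ M ∧
      (S.weight n i ≤ M → (S.truncate M).weight n i = S.weight n i) := by
  induction n generalizing i with
  | zero => exact ⟨hM, fun _ => rfl⟩
  | succ n ih =>
    obtain ⟨h1, h2⟩ := ih (i / 2)
    have h3 : (S.truncate M).weight (n + 1) i =
      (S.truncate M).weight n (i / 2) * √(1 + (S.truncate M).slope n (i / 2) ^ 2) := rfl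
    rw [S.truncate_slope rfl] at h3
    split_ifs at h3 with h4
    · rw [h2 ((S.weight_le_weight_succ n i).trans h4)] at h3
      have h5 : (S.truncate M).weight (n + 1) i = S.weight (n + 1) i := h3
      exact ⟨h5.trans_le h4, fun _ => h5⟩
    · refine ⟨?_, fun h => absurd h h4⟩
      rw [h3]
      simpa using h1

theorem truncate_node {M : ℝ} {n i : ℕ} (h : S.weight n i ≤ M) :
    (S.truncate M).node n i = S.node n i ∧ (S.truncate M).node n (i + 1) = S.node n (i + 1) := by
  induction n generalizing i with
  | zero => exact ⟨rfl, rfl⟩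
  | succ n ih =>
    obtain ⟨h1, h2⟩ := ih ((S.weight_le_weight_succ n i).trans h)
    have h3 := S.truncate_slope (M := M) (n := n) (rfl : i / 2 = i / 2)
    rw [if_pos h] at h3
    obtain ⟨k, rfl | rfl⟩ := Nat.even_or_odd' i
    · rw [show 2 * k / 2 = k by omega] at h1 h2 h3
      rw [node_succ_even, node_succ_even, node_succ_odd, node_succ_odd, pt, pt, h1, h2, h3]
      exact ⟨rfl, rfl⟩
    · rw [show (2 * k + 1) / 2 = k by omega] at h1 h2 h3
      rw [show 2 * k + 1 + 1 = 2 * (k + 1) by ring, node_succ_even, node_succ_even, node_succ_odd,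
        node_succ_odd, pt, pt, h1, h2, h3]
      exact ⟨rfl, rfl⟩

theorem density_le_ofReal_iff {M : ℝ} (hM : 0 ≤ M) {t : ℝ} :
    S.density t ≤ ENNReal.ofReal M ↔ ∀ n, S.weight n (dyadicIndex n t) ≤ M := by
  rw [density, iSup_le_iff]
  exact forall_congr' fun n => ENNReal.ofReal_le_ofReal_iff hM

theorem truncate_curve {M : ℝ} {t : ℝ} (h : ∀ n, S.weight n (dyadicIndex n t) ≤ M) :
    (S.truncate M).curve t = S.curve t := by
  rw [curve, curve]
  congr 1
  funext n
  exact (S.truncate_node (h n)).1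

theorem truncate_density {M : ℝ} (hM : 1 ≤ M) {t : ℝ}
    (h : ∀ n, S.weight n (dyadicIndex n t) ≤ M) : (S.truncate M).density t = S.density t :=
  iSup_congr fun n => by rw [(S.truncate_weight hM n _).2 (h n)]

theorem truncate_stretchMeasure_ne_top {M : ℝ} (hM : 1 ≤ M) :
    (S.truncate M).stretchMeasure Set.univ ≠ ∞ := by
  rw [stretchMeasure, Measure.smul_apply, withDensity_apply _ MeasurableSet.univ,
    Measure.restrict_univ, smul_eq_mul]
  refine ENNReal.mul_ne_top ENNReal.ofReal_ne_top
    (ne_top_of_le_ne_top (b := ENNReal.ofReal M) ?_ ?_)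
  · exact ENNReal.ofReal_ne_top
  · calc _ ≤ ∫⁻ _ in Set.Ico (0 : ℝ) 1, ENNReal.ofReal M :=
          lintegral_mono fun t => ((S.truncate M).density_le_ofReal_iff (by linarith)).2
            fun n => (S.truncate_weight hM n _).1
      _ = _ := by simp

/-- Where the infinite product is bounded, the limit curve and the product agree with those of a
stopped tree, whose polygonal lines have bounded length. -/
theorem curveMeasure_eq_of_density_le {M : ℝ} (hM : 1 ≤ M) {s : Set ℝ} (hs : MeasurableSet s)
    (hs1 : s ⊆ Set.Ico 0 1) (h : ∀ t ∈ s, S.density t ≤ ENNReal.ofReal M) :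
    S.curveMeasure s = S.stretchMeasure s := by
  have h' : ∀ t ∈ s, ∀ n, S.weight n (dyadicIndex n t) ≤ M :=
    fun t ht => (S.density_le_ofReal_iff (by linarith)).1 (h t ht)
  have h1 : (S.truncate M).curveMeasure s = (S.truncate M).stretchMeasure s := by
    rw [(S.truncate M).curveMeasure_eq (S.truncate_stretchMeasure_ne_top hM)]
  rw [curveMeasure_apply, stretchMeasure_apply _ hs hs1, Set.inter_eq_left.2 hs1,
    setLIntegral_congr_fun hs fun t ht => S.truncate_density hM (h' t ht),
    Set.image_congr fun t ht => S.truncate_curve (h' t ht)] at h1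
  rw [curveMeasure_apply, stretchMeasure_apply _ hs hs1, Set.inter_eq_left.2 hs1, h1]
  rfl

theorem curveMeasure_eq_of_density_ne_top {s : Set ℝ} (hs : MeasurableSet s)
    (hs1 : s ⊆ Set.Ico 0 1) (h : ∀ t ∈ s, S.density t ≠ ∞) :
    S.curveMeasure s = S.stretchMeasure s := by
  let u (n : ℕ) : Set ℝ := s ∩ {t | S.density t ≤ ENNReal.ofReal (n + 1)}
  have hu : ⋃ n, u n = s := by
    refine subset_antisymm (Set.iUnion_subset fun n => Set.inter_subset_left) fun t ht => ?_
    obtain ⟨n, hn⟩ := exists_nat_ge (S.density t).toReal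
    refine Set.mem_iUnion.2 ⟨n, ht, ?_⟩
    rw [Set.mem_ofPred_eq, ← ENNReal.ofReal_toReal (h t ht)]
    exact ENNReal.ofReal_le_ofReal (by linarith)
  have hmono : Monotone u := fun m n hmn t ht =>
    ⟨ht.1, le_trans ht.2 (ENNReal.ofReal_le_ofReal (by gcongr))⟩
  rw [← hu]
  refine tendsto_nhds_unique (tendsto_measure_iUnion_atTop hmono) ?_
  refine (tendsto_measure_iUnion_atTop hmono).congr fun n => ?_
  exact (S.curveMeasure_eq_of_density_le (M := n + 1) (by simp)
    (hs.inter (measurableSet_le S.measurable_density measurable_const))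
    (Set.inter_subset_left.trans hs1) fun t ht => ht.2).symm

/-- The area formula for the limit curve, on sets of times at which the infinite product is
finite. -/
theorem hausdorffMeasure_curve_image {s : Set ℝ} (hs : NullMeasurableSet s)
    (hs1 : s ⊆ Set.Ico 0 1) (h : ∀ t ∈ s, S.density t ≠ ∞) :
    (Measure.hausdorffMeasure 1 : Measure Plane) (S.curve '' s) =
      ENNReal.ofReal (dist S.a S.b) * ∫⁻ t in s, S.density t := by
  -- A null set of finite times is contained in such a set that is measurable.
  have hnull {z : Set ℝ} (hz : volume z = 0) (hz1 : z ⊆ Set.Ico 0 1)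
      (hzf : ∀ t ∈ z, S.density t ≠ ∞) : S.curveMeasure z = 0 := by
    obtain ⟨w, hzw, hw, hw0⟩ := exists_measurable_superset_of_null hz
    have hm : MeasurableSet (w ∩ Set.Ico 0 1 ∩ {t | S.density t ≠ ∞}) :=
      (hw.inter measurableSet_Ico).inter S.measurableSet_density_ne_top
    refine measure_mono_null (t := w ∩ Set.Ico 0 1 ∩ {t | S.density t ≠ ∞})
      (fun t ht => ⟨⟨hzw ht, hz1 ht⟩, hzf t ht⟩) ?_
    have hsub : w ∩ Set.Ico 0 1 ∩ {t | S.density t ≠ ∞} ⊆ Set.Ico 0 1 := fun t ht => ht.1.2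
    rw [S.curveMeasure_eq_of_density_ne_top hm hsub fun t ht => ht.2,
      S.stretchMeasure_apply hm hsub, setLIntegral_measure_zero _ _
        (measure_mono_null (fun t ht => ht.1.1) hw0), mul_zero]
  obtain ⟨v, hvs, hv, hve⟩ := hs.exists_measurable_subset_ae_eq
  have h0 : volume (s \ v) = 0 := (ae_le_set.1 hve.symm.le)
  have h1 : S.curveMeasure s = S.curveMeasure v := by
    rw [← measure_inter_add_sdiff s hv, Set.inter_eq_right.2 hvs,
      hnull h0 (Set.sdiff_subset.trans hs1) fun t ht => h t ht.1, add_zero]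
  rw [setLIntegral_congr hve.symm, ← S.stretchMeasure_apply hv (hvs.trans hs1),
    ← S.curveMeasure_eq_of_density_ne_top hv (hvs.trans hs1) fun t ht => h t (hvs ht), ← h1,
    curveMeasure_apply, Set.inter_eq_left.2 hs1]

/-- The images of the times with finite and with infinite product are measurably separated. -/
theorem hausdorffMeasure_curve_split (s : Set ℝ) (hs1 : s ⊆ Set.Ico 0 1) :
    (Measure.hausdorffMeasure 1 : Measure Plane) (S.curve '' s) =
      (Measure.hausdorffMeasure 1 : Measure Plane) (S.curve '' (s ∩ {t | S.density t ≠ ∞})) +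
      (Measure.hausdorffMeasure 1 : Measure Plane) (S.curve '' (s ∩ {t | S.density t = ∞})) := by
  have h := measure_inter_add_sdiff (μ := S.curveMeasure) s S.measurableSet_density_ne_top
  rw [curveMeasure_apply, curveMeasure_apply, curveMeasure_apply, Set.inter_eq_left.2 hs1,
    Set.inter_eq_left.2 (Set.inter_subset_left.trans hs1),
    Set.inter_eq_left.2 (Set.sdiff_subset.trans hs1)] at h
  rw [← h]
  congr 4
  ext t
  simp

end SlopeTree

/-! ### Koch type constructions as slope trees -/

theorem convex_triangle (t : ℝ) : Convex ℝ (triangle t) := by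
  rintro ⟨x, y⟩ ⟨h1, h2, h3, h4, h5⟩ ⟨x', y'⟩ ⟨h1', h2', h3', h4', h5'⟩ c d hc hd hcd
  obtain rfl : d = 1 - c := by linarith
  simp only at h1 h2 h3 h4 h5 h1' h2' h3' h4' h5'
  refine ⟨?_, ?_, ?_, ?_, ?_⟩ <;> simp only [Prod.smul_mk, Prod.mk_add_mk, smul_eq_mul] <;>
    nlinarith

namespace SlopeTree

variable (S : SlopeTree)

/-- Frame coordinates are affine. -/
theorem pt_combination (n i : ℕ) {c d : ℝ} (h : c + d = 1) (x y x' y' : ℝ) :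
    c • S.pt n i x y + d • S.pt n i x' y' = S.pt n i (c * x + d * x') (c * y + d * y') := by
  obtain rfl : d = 1 - c := by linarith
  unfold pt frame
  module

theorem convex_cap (n i : ℕ) : Convex ℝ (S.cap n i) := by
  rintro _ ⟨x, y, h, rfl⟩ _ ⟨x', y', h', rfl⟩ c d hc hd hcd
  exact ⟨c * x + d * x', c * y + d * y', convex_triangle _ h h' hc hd hcd,
    S.pt_combination n i hcd x y x' y'⟩

theorem cap_eq_convexHull {n i : ℕ} (h : 0 < S.slope n i) :
    S.cap n i =
      convexHull ℝ {S.node n i, S.node n (i + 1), S.pt n i (1 / 2) (S.slope n i / 2)} := by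
  refine subset_antisymm ?_ (convexHull_min ?_ (S.convex_cap n i))
  · rintro _ ⟨x, y, ⟨-, -, h1, h2, h3⟩, rfl⟩
    simp only at h1 h2 h3
    set t := S.slope n i
    -- The barycentric coordinates of the point.
    have h4 : y / t ≤ x := by rwa [div_le_iff₀' h]
    have h5 : y / t ≤ 1 - x := by rwa [div_le_iff₀' h]
    have h6 : 0 ≤ y / t := by positivity
    have hconv := convex_convexHull ℝ
      {S.node n i, S.node n (i + 1), S.pt n i (1 / 2) (t / 2)}
    have hmem := hconv.sum_mem (t := Finset.univ)
      (w := ![1 - x - y / t, x - y / t, 2 * (y / t)])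
      (z := ![S.node n i, S.node n (i + 1), S.pt n i (1 / 2) (t / 2)]) ?_ ?_ ?_
    · convert hmem using 1
      simp only [Fin.sum_univ_three, Matrix.cons_val_zero, Matrix.cons_val_one, Matrix.cons_val]
      have h7 : y = (y / t) * t := by field_simp
      unfold pt frame
      generalize y / t = u at h7
      subst h7
      module
    · intro j _
      fin_cases j <;> simp <;> linarith
    · simp [Fin.sum_univ_three]; ring
    · intro j _
      apply subset_convexHull
      fin_cases j <;> simp
  · rintro p (rfl | rfl | rfl)
    · exact S.node_mem_cap n i
    · exact S.node_succ_mem_cap n i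
    · refine ⟨_, _, ⟨?_, ?_, ?_, ?_, ?_⟩, rfl⟩ <;> simp only <;> linarith

end SlopeTree

namespace Construction

variable (K : Construction)

theorem theta_le (n i : ℕ) (hi : i < 2 ^ n) : K.θ n i ≤ Real.arctan (2 * K.ε) := by
  induction n generalizing i with
  | zero =>
    obtain rfl : i = 0 := by simpa using hi
    exact K.θ_zero.le
  | succ n ih => exact (K.θ_le n i hi).trans (ih _ (by rw [pow_succ] at hi; omega))

theorem theta_mem {n i : ℕ} (hi : i < 2 ^ n) : K.θ n i ∈ Set.Ioo 0 (Real.pi / 2) :=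
  ⟨K.θ_pos n i hi, (K.theta_le n i hi).trans_lt (Real.arctan_lt_pi_div_two _)⟩

/-- The slopes of a construction, with degenerate caps outside of the range of its indices. -/
def slopeTree : SlopeTree where
  a := K.a
  b := K.b
  a_ne_b := K.a_ne_b
  slope n i := if i < 2 ^ n then Real.tan (K.θ n i) else 0
  slope_nonneg n i := by
    split_ifs with h
    exacts [(Real.tan_pos_of_pos_of_lt_pi_div_two (K.theta_mem h).1 (K.theta_mem h).2).le, le_rfl]
  slope_zero_le i := by
    split_ifs with h
    · obtain rfl : i = 0 := by simpa using h
      rw [K.θ_zero, Real.tan_arctan]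
      linarith [K.ε_lt]
    · norm_num
  slope_succ_le n i := by
    by_cases h : i < 2 ^ (n + 1)
    · have h' : i / 2 < 2 ^ n := by rw [pow_succ] at h; omega
      rw [if_pos h, if_pos h']
      refine Real.strictMonoOn_tan.monotoneOn ?_ ?_ (K.θ_le n i h)
      · exact ⟨by linarith [(K.theta_mem h).1, Real.pi_pos], (K.theta_mem h).2⟩
      · exact ⟨by linarith [(K.theta_mem h').1, Real.pi_pos], (K.theta_mem h').2⟩
    · have h' : ¬ i / 2 < 2 ^ n := by rw [pow_succ] at h; omega
      rw [if_neg h, if_neg h']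

theorem slopeTree_slope {n i : ℕ} (hi : i < 2 ^ n) :
    K.slopeTree.slope n i = Real.tan (K.θ n i) := if_pos hi

theorem apexOver_eq_frame (n : ℕ) (t : ℝ) (l r : Plane) :
    apexOver n t l r = frame ((-1) ^ n) l r (1 / 2) (Real.tan t / 2) := by
  rw [apexOver, frame, midpoint_eq_smul_add]
  simp only [invOf_eq_inv]
  module

theorem vertex_eq_node {n k : ℕ} (hk : k ≤ 2 ^ n) : K.vertex n k = K.slopeTree.node n k := by
  induction n generalizing k with
  | zero => rfl
  | succ n ih =>
    rw [pow_succ] at hk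
    rw [vertex, SlopeTree.node]
    split_ifs with h
    · exact ih (by omega)
    · rw [apexOver_eq_frame, ih (by omega), ih (by omega), K.slopeTree_slope (by omega)]

theorem apex_eq_pt {n i : ℕ} (hi : i < 2 ^ n) :
    K.apex n i = K.slopeTree.pt n i (1 / 2) (K.slopeTree.slope n i / 2) := by
  rw [apex, apexOver_eq_frame, K.vertex_eq_node hi.le, K.vertex_eq_node hi, K.slopeTree_slope hi]
  rfl

theorem cap_eq {n i : ℕ} (hi : i < 2 ^ n) : K.cap n i = K.slopeTree.cap n i := by
  rw [cap, SlopeTree.cap_eq_convexHull, K.apex_eq_pt hi, K.vertex_eq_node hi.le,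
    K.vertex_eq_node hi]
  rw [K.slopeTree_slope hi]
  exact Real.tan_pos_of_pos_of_lt_pi_div_two (K.theta_mem hi).1 (K.theta_mem hi).2

theorem side_subset {n i : ℕ} (hi : i < 2 ^ n) : K.side n i ⊆ K.slopeTree.cap n i := by
  rw [← K.cap_eq hi]
  exact segment_subset_convexHull (by simp) (by simp)

theorem sideIndex_pt {n i : ℕ} (hi : i < 2 ^ n) {f : ℝ} (h0 : 0 < f) (h1 : f < 1) :
    K.sideIndex n (K.slopeTree.pt n i f 0) = i := by
  have hmem : K.slopeTree.pt n i f 0 ∈ K.side n i := by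
    rw [side, K.vertex_eq_node hi.le, K.vertex_eq_node hi, ← SlopeTree.pt_zero, ← SlopeTree.pt_one]
    exact ⟨1 - f, f, by linarith, h0.le, by ring,
      by rw [SlopeTree.pt_combination _ _ _ (by ring)]; simp⟩
  have : {j | j < 2 ^ n ∧ K.slopeTree.pt n i f 0 ∈ K.side n j} = {i} := by
    ext j
    refine ⟨fun ⟨hj, h⟩ => ?_, fun h => by rw [h]; exact ⟨hi, hmem⟩⟩
    have h2 := K.side_subset hi hmem
    have h3 := K.side_subset hj h
    rcases lt_trichotomy i j with h4 | h4 | h4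
    · obtain ⟨rfl, h5⟩ := K.slopeTree.eq_of_mem_cap_of_lt h4 hj h2 h3
      rw [← SlopeTree.pt_one] at h5
      exact absurd (K.slopeTree.pt_inj hi h5).1 h1.ne
    · exact h4.symm
    · obtain ⟨-, h5⟩ := K.slopeTree.eq_of_mem_cap_of_lt h4 hi h3 h2
      rw [← SlopeTree.pt_zero] at h5
      exact absurd (K.slopeTree.pt_inj hi h5).1 h0.ne'
  rw [sideIndex, this, csSup_singleton]

theorem lift_pt {n i : ℕ} (hi : i < 2 ^ n) {f : ℝ} (h0 : 0 ≤ f) (h1 : f ≤ 1) :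
    K.lift n i (K.slopeTree.pt n i f 0) =
      K.slopeTree.pt n i f (K.slopeTree.slope n i * min f (1 - f)) := by
  have hl := K.slopeTree.len_pos hi
  have h2 : dist (K.slopeTree.pt n i f 0) (K.slopeTree.node n i) = K.slopeTree.len n i * f := by
    rw [← SlopeTree.pt_zero, SlopeTree.dist_pt]
    simp [Real.sqrt_sq h0]
  have h3 : dist (K.slopeTree.pt n i f 0) (K.slopeTree.node n (i + 1)) =
      K.slopeTree.len n i * (1 - f) := by
    rw [← SlopeTree.pt_one, SlopeTree.dist_pt, sub_self, show f - 1 = -(1 - f) by ring, neg_sq]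
    simp [Real.sqrt_sq (sub_nonneg.2 h1)]
  rw [lift, K.vertex_eq_node hi.le, K.vertex_eq_node hi, h2, h3, ← mul_min_of_nonneg _ _ hl.le,
    ← K.slopeTree_slope hi,
    show dist (K.slopeTree.node n i) (K.slopeTree.node n (i + 1)) = K.slopeTree.len n i from rfl,
    mul_left_comm, mul_div_cancel_left₀ _ hl.ne']
  unfold SlopeTree.pt frame
  module

theorem fract_mem {t : ℝ} (ht : t ∈ Set.Ico (0 : ℝ) 1) (htd : t ∉ dyadics) (n : ℕ) :
    0 < 2 ^ n * t - dyadicIndex n t ∧ 2 ^ n * t - dyadicIndex n t < 1 := by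
  have h0 : 0 ≤ 2 ^ n * t := mul_nonneg (by positivity) ht.1
  refine ⟨sub_pos.2 (lt_of_le_of_ne (Nat.floor_le h0) fun h => htd ?_), ?_⟩
  · rw [show t = (dyadicIndex n t : ℝ) / 2 ^ n by rw [h]; field_simp]
    exact div_mem_dyadics _ _
  · linarith [Nat.lt_floor_add_one (2 ^ n * t), show (dyadicIndex n t : ℝ) = ⌊2 ^ n * t⌋₊ from rfl]

/-- The maps `f_{n-1} ∘ ⋯ ∘ f_0` run through the polygonal lines with the parametrization in which
all segments of the same stage take the same time. -/
theorem approx_lineMap {t : ℝ} (ht : t ∈ Set.Ico (0 : ℝ) 1) (htd : t ∉ dyadics) (n : ℕ) :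
    K.approx n (AffineMap.lineMap K.a K.b t) =
      K.slopeTree.pt n (dyadicIndex n t) (2 ^ n * t - dyadicIndex n t) 0 := by
  induction n with
  | zero =>
    have h : dyadicIndex 0 t = 0 := by
      have := dyadicIndex_lt (n := 0) ht.2
      simpa using this
    rw [h, approx, AffineMap.lineMap_apply_module', SlopeTree.pt, frame]
    simp [SlopeTree.node, slopeTree, add_comm]
  | succ n ih =>
    have hi := dyadicIndex_lt (n := n) ht.2
    obtain ⟨h0, h1⟩ := fract_mem ht htd n
    obtain ⟨h0', h1'⟩ := fract_mem ht htd (n + 1)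
    rw [approx, ih, step, K.sideIndex_pt hi h0 h1, K.lift_pt hi h0.le h1.le]
    have h2 := dyadicIndex_succ_div n t
    obtain ⟨k, hk | hk⟩ := Nat.even_or_odd' (dyadicIndex (n + 1) t)
    · obtain rfl : k = dyadicIndex n t := by omega
      rw [hk, pow_succ] at h0' h1'
      push_cast at h0' h1'
      rw [hk, SlopeTree.pt_succ_even, min_eq_left (by linarith), pow_succ]
      congr 1 <;> push_cast <;> ring
    · obtain rfl : k = dyadicIndex n t := by omega
      rw [hk, pow_succ] at h0' h1'
      push_cast at h0' h1'
      rw [hk, SlopeTree.pt_succ_odd, min_eq_right (by linarith), pow_succ]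
      congr 1 <;> push_cast <;> ring

theorem F_lineMap {t : ℝ} (ht : t ∈ Set.Ico (0 : ℝ) 1) (htd : t ∉ dyadics) :
    K.F (AffineMap.lineMap K.a K.b t) = K.slopeTree.curve t := by
  refine (K.slopeTree.tendsto_curve_of_mem_cap fun n => ?_).limUnder_eq
  obtain ⟨h0, h1⟩ := fract_mem ht htd n
  have hs := K.slopeTree.slope_nonneg n (dyadicIndex n t)
  rw [K.approx_lineMap ht htd n]
  exact ⟨_, _, ⟨h0.le, h1.le, le_rfl, by positivity, mul_nonneg hs (by linarith)⟩, rfl⟩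

theorem capIndex_curve {t : ℝ} (ht : t ∈ Set.Ico (0 : ℝ) 1) (htd : t ∉ dyadics) (n : ℕ) :
    K.capIndex n (K.slopeTree.curve t) = dyadicIndex n t := by
  have : {i | i < 2 ^ n ∧ K.slopeTree.curve t ∈ K.cap n i} = {dyadicIndex n t} := by
    ext i
    constructor
    · rintro ⟨hi, h⟩
      rw [K.cap_eq hi] at h
      exact K.slopeTree.eq_of_curve_mem_cap ht htd hi h
    · rintro rfl
      have hi := dyadicIndex_lt (n := n) ht.2
      exact ⟨hi, by rw [K.cap_eq hi]; exact K.slopeTree.curve_mem_cap n t⟩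
  rw [capIndex, this, csSup_singleton]

theorem partialStretch_curve {t : ℝ} (ht : t ∈ Set.Ico (0 : ℝ) 1) (htd : t ∉ dyadics) (n : ℕ) :
    K.partialStretch n (K.slopeTree.curve t) =
      ENNReal.ofReal (K.slopeTree.weight (n + 1) (dyadicIndex (n + 1) t)) := by
  have hfac (j : ℕ) : (Real.cos (K.θ j (K.capIndex j (K.slopeTree.curve t))))⁻¹ =
      √(1 + K.slopeTree.slope j (dyadicIndex j t) ^ 2) := by
    have hj := dyadicIndex_lt (n := j) ht.2
    have hθ := K.theta_mem hj
    rw [K.capIndex_curve ht htd, K.slopeTree_slope hj, ← Real.inv_sqrt_one_add_tan_sq, inv_inv]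
    exact Real.cos_pos_of_mem_Ioo ⟨by linarith [hθ.1, Real.pi_pos], hθ.2⟩
  rw [partialStretch]
  have hw (m : ℕ) : ∏ j ∈ Finset.range m,
      ENNReal.ofReal (Real.cos (K.θ j (K.capIndex j (K.slopeTree.curve t))))⁻¹ =
      ENNReal.ofReal (K.slopeTree.weight m (dyadicIndex m t)) := by
    induction m with
    | zero => simp [SlopeTree.weight]
    | succ m ih =>
      rw [Finset.prod_range_succ, ih, hfac, ← ENNReal.ofReal_mul
        (zero_le_one.trans (K.slopeTree.one_le_weight _ _)), SlopeTree.weight,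
        dyadicIndex_succ_div]
  exact hw (n + 1)

theorem stretch_curve {t : ℝ} (ht : t ∈ Set.Ico (0 : ℝ) 1) (htd : t ∉ dyadics) :
    K.stretch (K.slopeTree.curve t) = K.slopeTree.density t := by
  rw [stretch, SlopeTree.density, iSup_congr (K.partialStretch_curve ht htd)]
  exact Monotone.iSup_nat_add
    (f := fun n => ENNReal.ofReal (K.slopeTree.weight n (dyadicIndex n t)))
    (fun m n h => ENNReal.ofReal_le_ofReal (K.slopeTree.monotone_weight t h)) 1

/-- Points at times that are not dyadic are not vertices, so they belong to both Koch type sets. -/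
theorem curve_mem_of_isKochType {A : Set Plane} (hA : K.IsKochType A) {t : ℝ}
    (ht : t ∈ Set.Ico (0 : ℝ) 1) (htd : t ∉ dyadics) : K.slopeTree.curve t ∈ A := by
  have h1 : K.slopeTree.curve t ∈ K.limitSet := by
    refine Set.mem_iInter.2 fun n => ?_
    have hi := dyadicIndex_lt (n := n) ht.2
    refine Set.mem_biUnion (Finset.mem_coe.2 (Finset.mem_range.2 hi)) ?_
    rw [K.cap_eq hi]
    exact K.slopeTree.curve_mem_cap n t
  rcases hA with rfl | rfl
  · exact h1
  · refine ⟨h1, fun h2 => ?_⟩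
    simp only [edgePoints, Set.mem_iUnion, Finset.mem_range, exists_prop] at h2
    obtain ⟨n, -, i, hi, h2⟩ := h2
    rw [K.vertex_eq_node hi.le, K.vertex_eq_node hi, K.apex_eq_pt hi, ← SlopeTree.node_succ_odd]
      at h2
    rcases h2 with h2 | h2 | h2
    · exact K.slopeTree.curve_ne_node ht htd hi.le h2
    · exact K.slopeTree.curve_ne_node ht htd hi h2
    · exact K.slopeTree.curve_ne_node ht htd (by rw [pow_succ]; omega) h2

theorem continuous_lineMap : Continuous (AffineMap.lineMap K.a K.b : ℝ → Plane) :=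
  AffineMap.lineMap_continuous

theorem base_eq_image : K.base = AffineMap.lineMap K.a K.b '' Set.Icc (0 : ℝ) 1 :=
  segment_eq_image_lineMap ℝ K.a K.b

/-- Arc length on a part of the base, in terms of Lebesgue measure on the parameters. -/
theorem hausdorffMeasure_restrict_base {E : Set Plane} (hE : E ⊆ K.base) :
    (Measure.hausdorffMeasure 1 : Measure Plane).restrict E =
      (ENNReal.ofReal (dist K.a K.b) •
        volume.restrict ((AffineMap.lineMap K.a K.b : ℝ → Plane) ⁻¹' E)).map
          (AffineMap.lineMap K.a K.b) := by
  have hγ : Measurable (AffineMap.lineMap K.a K.b : ℝ → Plane) :=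
    K.continuous_lineMap.measurable
  ext s hs
  have hrange : s ∩ E ⊆ Set.range (AffineMap.lineMap K.a K.b : ℝ → Plane) := fun p hp => by
    have := hE hp.2
    rw [base_eq_image] at this
    exact Set.image_subset_range _ _ this
  rw [Measure.restrict_apply hs, Measure.map_apply hγ hs, Measure.smul_apply,
    Measure.restrict_apply (hγ hs), ← Set.preimage_inter]
  conv_lhs => rw [← Set.image_preimage_eq_of_subset hrange, hausdorffMeasure_lineMap_image]
  rw [hausdorffMeasure_real, ← edist_dist, edist_nndist]
  rfl

end Construction

/-- Countable sets are negligible for one-dimensional Hausdorff measure. -/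
theorem hausdorffMeasure_eq_of_countable {X Y C : Set Plane} (hXY : X ⊆ Y) (hYX : Y ⊆ X ∪ C)
    (hC : C.Countable) :
    (Measure.hausdorffMeasure 1 : Measure Plane) Y = Measure.hausdorffMeasure 1 X := by
  have := Measure.nullSingletonClass_hausdorff Plane (d := 1) one_pos
  refine le_antisymm ?_ (measure_mono hXY)
  refine (measure_mono hYX).trans ((measure_union_le _ _).trans ?_)
  rw [hC.measure_zero, add_zero]

end Koch

end

theorem theorem12 (K : Koch.Construction) (A : Set Koch.Plane) (hA : K.IsKochType A)
    (B : Set Koch.Plane) (hB : B ⊆ K.base)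
    (hBm : NullMeasurableSet B (Measure.hausdorffMeasure 1 : Measure Koch.Plane)) :
    (Measure.hausdorffMeasure 1 : Measure Koch.Plane) (K.F '' B) =
      (∫⁻ x in B \ K.lambdaInfPreimage A, K.baseStretch x
          ∂(Measure.hausdorffMeasure 1 : Measure Koch.Plane)) +
        (Measure.hausdorffMeasure 1 : Measure Koch.Plane) (K.F '' B ∩ K.lambdaInf A) := by
  set S := K.slopeTree
  set γ : ℝ → Koch.Plane := (AffineMap.lineMap K.a K.b : ℝ → Koch.Plane) with hγ
  have hγe : MeasurableEmbedding γ := K.continuous_lineMap.measurableEmbedding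
    (AffineMap.lineMap_injective ℝ K.a_ne_b)
  -- The times of the points of `B`, without the countable set of dyadic times.
  set T : Set ℝ := γ ⁻¹' B \ Koch.dyadics
  have hBγ : B = γ '' (γ ⁻¹' B) := by
    refine (Set.image_preimage_eq_of_subset fun p hp => ?_).symm
    have := hB hp
    rw [K.base_eq_image] at this
    exact Set.image_subset_range _ _ this
  have hT1 : T ⊆ Set.Ico 0 1 := by
    rintro t ⟨ht, htd⟩
    have := hB ht
    rw [K.base_eq_image] at this
    obtain ⟨s, hs, hst⟩ := this
    obtain rfl := AffineMap.lineMap_injective ℝ K.a_ne_b hst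
    refine ⟨hs.1, lt_of_le_of_ne hs.2 ?_⟩
    rintro rfl
    exact htd (by simpa using Koch.div_mem_dyadics 0 1)
  have hF : ∀ t ∈ T, K.F (γ t) = S.curve t := fun t ht => K.F_lineMap (hT1 ht) ht.2
  have hΛ : ∀ t ∈ T, (S.curve t ∈ K.lambdaInf A ↔ S.density t = ∞) := fun t ht => by
    rw [Koch.Construction.lambdaInf, Set.mem_ofPred_eq, K.stretch_curve (hT1 ht) ht.2]
    exact and_iff_right (K.curve_mem_of_isKochType hA (hT1 ht) ht.2)
  have hd0 : volume Koch.dyadics = 0 := Koch.countable_dyadics.measure_zero _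
  -- `γ` pulls null sets back to null sets.
  have hqmp : Measure.QuasiMeasurePreserving γ volume
      (Measure.hausdorffMeasure 1 : Measure Koch.Plane) := by
    refine ⟨hγe.measurable, Measure.AbsolutelyContinuous.mk fun s hs h => ?_⟩
    have h1 := measure_mono_null (Set.image_preimage_subset γ s) h
    rw [hγ, hausdorffMeasure_lineMap_image, hausdorffMeasure_real] at h1
    rw [Measure.map_apply hγe.measurable hs]
    rw [Measure.nnreal_smul_coe_apply] at h1
    simpa [K.a_ne_b] using h1
  have hTm : NullMeasurableSet T := (hBm.preimage hqmp).diff (NullMeasurableSet.of_null hd0)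
  have hC : (K.F '' (γ '' Koch.dyadics)).Countable := (Koch.countable_dyadics.image _).image _
  have hcover : K.F '' B ⊆ S.curve '' T ∪ K.F '' (γ '' Koch.dyadics) := by
    rw [hBγ]
    rintro _ ⟨_, ⟨t, ht, rfl⟩, rfl⟩
    by_cases htd : t ∈ Koch.dyadics
    · exact Or.inr ⟨_, ⟨t, htd, rfl⟩, rfl⟩
    · exact Or.inl ⟨t, ⟨ht, htd⟩, (hF t ⟨ht, htd⟩).symm⟩
  have hsub : S.curve '' T ⊆ K.F '' B := by
    rintro _ ⟨t, ht, rfl⟩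
    exact ⟨γ t, ht.1, hF t ht⟩
  rw [Koch.hausdorffMeasure_eq_of_countable hsub hcover hC, S.hausdorffMeasure_curve_split T hT1]
  congr 1
  · have hTf : NullMeasurableSet (T ∩ {t | S.density t ≠ ∞}) :=
      hTm.inter S.measurableSet_density_ne_top.nullMeasurableSet
    rw [S.hausdorffMeasure_curve_image hTf
      (Set.inter_subset_left.trans hT1) fun t ht => ht.2,
      K.hausdorffMeasure_restrict_base (Set.sdiff_subset.trans hB), hγe.lintegral_map,
      lintegral_smul_measure, smul_eq_mul]
    have hae : (γ ⁻¹' (B \ K.lambdaInfPreimage A) : Set ℝ) =ᵐ[volume]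
        (T ∩ {t | S.density t ≠ ∞} : Set ℝ) := by
      filter_upwards [measure_eq_zero_iff_ae_notMem.1 hd0] with t htd
      refine propext ⟨fun h => ?_, fun h => ?_⟩
      · have ht : t ∈ T := ⟨h.1, htd⟩
        refine ⟨ht, fun hinf => h.2 ⟨hB h.1, ?_⟩⟩
        rw [hF t ht]
        exact (hΛ t ht).2 hinf
      · refine ⟨h.1.1, fun hinf => h.2 ((hΛ t h.1).1 ?_)⟩
        rw [← hF t h.1]
        exact hinf.2
    rw [setLIntegral_congr hae]
    congr 1
    refine lintegral_congr_ae ?_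
    filter_upwards [ae_restrict_mem₀ hTf] with t ht
    rw [Koch.Construction.baseStretch, hF t ht.1, K.stretch_curve (hT1 ht.1) ht.1.2]
  · refine (Koch.hausdorffMeasure_eq_of_countable ?_ ?_ hC).symm
    · rintro _ ⟨t, ht, rfl⟩
      exact ⟨hsub ⟨t, ht.1, rfl⟩, (hΛ t ht.1).2 ht.2⟩
    · rintro p ⟨hp, hpΛ⟩
      rcases hcover hp with ⟨t, ht, rfl⟩ | h
      · exact Or.inl ⟨t, ⟨ht, (hΛ t ht).1 hpΛ⟩, rfl⟩
      · exact Or.inr h
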